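/- For every integer $k>0$, the real projective space $\mathbb{R}P^{4k+1}$ is the boundary of a compact oriented manifold. That is, there exists a compact Hausdorff second countable smooth $(4k+2)$-dimensional manifold $W$ with boundary which is oriented (it carries an atlas of smooth charts, including charts onto open subsets of the half-space at boundary points, all of whose coordinate changes have positive Jacobian determinant), together with a smooth embedding $f:\mathbb{R}P^{4k+1}\to W$ whose image is exactly $\partial W$. Here $\mathbb{R}P^{n}$ is the set of lines through the origin of $\mathbb{R}^{n+1}$ with the quotient topology and the smooth structure given by its $n+1$ affine charts. -/

import Mathlib

open scoped Manifold ContDiff Topology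

noncomputable section

/-- Real projective `n`-space: the set of lines through the origin of `ℝⁿ⁺¹`. -/
def RealProjectiveSpace (n : ℕ) : Type :=
  Projectivization ℝ (Fin (n + 1) → ℝ)

namespace RealProjectiveSpace

variable {n : ℕ}

/-- The quotient map from the nonzero vectors onto projective space. -/
def mk (v : {v : Fin (n + 1) → ℝ // v ≠ 0}) : RealProjectiveSpace n :=
  Projectivization.mk' ℝ v

/-- Projective space carries the quotient topology. -/
instance : TopologicalSpace (RealProjectiveSpace n) :=
  TopologicalSpace.coinduced mk inferInstance

lemma isQuotientMap_mk : Topology.IsQuotientMap (mk : _ → RealProjectiveSpace n) where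
  surjective := by
    intro p
    induction p using Projectivization.ind with
    | h v hv => exact ⟨⟨v, hv⟩, rfl⟩
  eq_coinduced := rfl

lemma mk_eq_mk_iff (v w : {v : Fin (n + 1) → ℝ // v ≠ 0}) :
    mk v = mk w ↔ ∃ a : ℝ, a • (w : Fin (n + 1) → ℝ) = v :=
  Projectivization.mk_eq_mk_iff' ℝ v.1 w.1 v.2 w.2

/-- The open set of the points whose `i`-th homogeneous coordinate does not vanish. -/
def affineSet (i : Fin (n + 1)) : Set (RealProjectiveSpace n) :=
  {p | Projectivization.lift (K := ℝ) (V := Fin (n + 1) → ℝ) (fun v => v.1 i ≠ 0) (by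
    rintro ⟨a, ha⟩ ⟨b, hb⟩ t h
    have h0 : t ≠ 0 := by
      rintro rfl
      exact ha (by simpa using h)
    simp only at h
    simp [h, h0]) p}

/-- The affine coordinates `[x] ↦ (x_j / x_i)_{j ≠ i}`. -/
def affineCoord (i : Fin (n + 1)) (p : RealProjectiveSpace n) : EuclideanSpace ℝ (Fin n) :=
  Projectivization.lift (K := ℝ) (V := Fin (n + 1) → ℝ)
    (fun v => WithLp.toLp 2 fun j => v.1 (i.succAbove j) / v.1 i) (by
    rintro ⟨a, ha⟩ ⟨b, hb⟩ t h
    have h0 : t ≠ 0 := by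
      rintro rfl
      exact ha (by simpa using h)
    simp only at h
    congr 1
    funext j
    simp [h, mul_div_mul_left _ _ h0]) p

/-- The homogeneous vector with `i`-th coordinate `1` and the other coordinates given by `y`. -/
def homVec (i : Fin (n + 1)) (y : EuclideanSpace ℝ (Fin n)) :
    {v : Fin (n + 1) → ℝ // v ≠ 0} :=
  ⟨i.insertNth (1 : ℝ) (fun j => y j), fun h => by simpa using congrFun h i⟩

@[simp] lemma mk_mem_affineSet (i : Fin (n + 1)) (v : {v : Fin (n + 1) → ℝ // v ≠ 0}) :
    mk v ∈ affineSet i ↔ v.1 i ≠ 0 := Iff.rfl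

@[simp] lemma affineCoord_mk (i : Fin (n + 1)) (v : {v : Fin (n + 1) → ℝ // v ≠ 0}) :
    affineCoord i (mk v) = WithLp.toLp 2 fun j => v.1 (i.succAbove j) / v.1 i := rfl

lemma isOpen_affineSet (i : Fin (n + 1)) : IsOpen (affineSet (n := n) i) := by
  rw [← isQuotientMap_mk.isOpen_preimage]
  have : mk ⁻¹' affineSet (n := n) i = {v | v.1 i ≠ 0} := rfl
  rw [this]
  exact isOpen_ne_fun ((continuous_apply i).comp continuous_subtype_val) continuous_const

lemma continuous_homVec (i : Fin (n + 1)) : Continuous (homVec (n := n) i) := by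
  refine Continuous.subtype_mk ?_ _
  refine continuous_pi fun j => ?_
  induction j using i.succAboveCases with
  | x => simpa using continuous_const
  | p j => simpa using (by fun_prop : Continuous fun y : EuclideanSpace ℝ (Fin n) => y j)

/-- The `i`-th affine chart of projective space. -/
def affineChart (i : Fin (n + 1)) :
    OpenPartialHomeomorph (RealProjectiveSpace n) (EuclideanSpace ℝ (Fin n)) where
  toFun := affineCoord i
  invFun y := mk (homVec i y)
  source := affineSet i
  target := Set.univ
  map_source' _ _ := trivial
  map_target' y _ := by simp [homVec]
  left_inv' p hp := by
    obtain ⟨v, rfl⟩ := isQuotientMap_mk.surjective p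
    rw [mk_mem_affineSet] at hp
    rw [mk_eq_mk_iff]
    refine ⟨(v.1 i)⁻¹, ?_⟩
    funext j
    induction j using i.succAboveCases with
    | x => simp [homVec, hp]
    | p j => simp [homVec, div_eq_inv_mul]
  right_inv' y _ := by
    ext j
    simp [homVec]
  open_source := isOpen_affineSet i
  open_target := isOpen_univ
  continuousOn_toFun := by
    rw [isQuotientMap_mk.continuousOn_isOpen_iff (isOpen_affineSet i)]
    refine (PiLp.continuous_toLp 2 _).comp_continuousOn ?_
    refine continuousOn_pi.2 fun j => ?_
    refine ContinuousOn.div ?_ ?_ fun v hv => hv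
    · exact ((continuous_apply _).comp continuous_subtype_val).continuousOn
    · exact ((continuous_apply _).comp continuous_subtype_val).continuousOn
  continuousOn_invFun :=
    (isQuotientMap_mk.continuous.comp (continuous_homVec i)).continuousOn

lemma exists_mem_affineSet (p : RealProjectiveSpace n) : ∃ i, p ∈ affineSet i := by
  obtain ⟨v, rfl⟩ := isQuotientMap_mk.surjective p
  by_contra! h
  refine v.2 (funext fun i => ?_)
  simpa using h i

/-- The atlas of the `n + 1` affine charts. -/
instance : ChartedSpace (EuclideanSpace ℝ (Fin n)) (RealProjectiveSpace n) where
  atlas := Set.range affineChart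
  chartAt p := affineChart (exists_mem_affineSet p).choose
  mem_chart_source p := (exists_mem_affineSet p).choose_spec
  chart_mem_atlas _ := Set.mem_range_self _

/-- The affine charts make projective space a smooth manifold. -/
instance : IsManifold (𝓡 n) ∞ (RealProjectiveSpace n) := by
  refine isManifold_of_contDiffOn _ _ _ ?_
  rintro _ _ ⟨i, rfl⟩ ⟨i', rfl⟩
  have key : ∀ j : Fin (n + 1),
      ContDiff ℝ ∞ fun y : EuclideanSpace ℝ (Fin n) => (homVec i y).1 j := by
    intro j
    induction j using i.succAboveCases with
    | x => simpa [homVec] using contDiff_const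
    | p j =>
      simpa [homVec] using
        (by fun_prop : ContDiff ℝ ∞ fun y : EuclideanSpace ℝ (Fin n) => y j)
  have hmap : ContDiffOn ℝ ∞ (fun y : EuclideanSpace ℝ (Fin n) =>
      (WithLp.toLp 2 fun j => (homVec i y).1 (i'.succAbove j) / (homVec i y).1 i' :
        EuclideanSpace ℝ (Fin n))) {y | (homVec i y).1 i' ≠ 0} := by
    rw [contDiffOn_euclidean]
    intro j
    exact ContDiffOn.div (key _).contDiffOn (key _).contDiffOn fun y hy => hy
  refine hmap.mono ?_
  rintro y ⟨hy, -⟩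
  exact hy.2

end RealProjectiveSpace

/-- An orientation of the manifold with boundary `M`, given by an oriented atlas: a family of
smooth charts that cover `M` and whose coordinate changes all have positive Jacobian determinant,
also at boundary points (where the derivative is taken within the model half-space). -/
structure OrientedAtlas {E H : Type*} [NormedAddCommGroup E] [NormedSpace ℝ E]
    [TopologicalSpace H] (I : ModelWithCorners ℝ E H)
    (M : Type*) [TopologicalSpace M] [ChartedSpace H M] where
  charts : Set (OpenPartialHomeomorph M H)
  smooth : charts ⊆ IsManifold.maximalAtlas I ∞ M
  covers : ∀ x : M, ∃ e ∈ charts, x ∈ e.source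
  det_pos : ∀ e ∈ charts, ∀ e' ∈ charts, ∀ x ∈ e.source ∩ e'.source,
    0 < (fderivWithin ℝ (e'.extend I ∘ (e.extend I).symm) (Set.range I) (e.extend I x)).det

end

/-!
Real projective space of odd dimension `2m + 1` is the quotient of the unit sphere of `ℂᵐ⁺¹` by
`±1`, and sending a unit vector `z` to `z ⊗ z` identifies it with the unit circle bundle of the
tensor square of the tautological line bundle over complex projective space `ℂPᵐ`. It is therefore
the boundary of the unit disc bundle of this line bundle. The total space of the line bundle is a
complex manifold, and hence the disc bundle is oriented.

The disc bundle (`discBundle`) is a compact subset of a space of pairs of matrices: a line `ℓ` is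
recorded by its orthogonal projection and an element of `ℓ ⊗ ℓ` by a symmetric matrix. Its charts
are restrictions of smooth maps between open subsets of the ambient vector spaces, and
`HalfSpaceChart` shows that such a family makes a subset a manifold with boundary, so that
smoothness of the coordinate changes comes for free. There are two kinds of charts. The bundle charts
(`bundleChart`) are the holomorphic trivializations over the affine charts of `ℂPᵐ`, restricted to
the open disc bundle. The collar charts (`collarChart`) live off the zero section, where a point is
`z ⊗ z` for a vector `z ≠ 0` unique up to sign; their coordinates are `1 - |z|²` and the real affine
coordinates of the real line through `z`, so that in these charts the embedding of real projective
space is linear (`isSmoothEmbedding_boundaryMap`).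

For the orientation, coordinate changes between bundle charts are holomorphic, so their real
Jacobian determinant is the squared absolute value of a complex one. Off the zero section all charts
are compared with the real coordinates of `z`. A collar chart is an even function of `z` with
nonvanishing Jacobian on `{z_i ≠ 0}`; since `{z_i > 0}` is connected and the real dimension `2m + 2`
is even, its Jacobian has a constant sign (`exists_collarSign`), which is made positive by changing
the sign of the `2m + 1` affine coordinates.
-/

noncomputable section

/-! ### Subsets of a normed space with half-space parametrizations -/

section HalfSpaceChart

open Set

variable {V : Type*} [NormedAddCommGroup V] [NormedSpace ℝ V] {n : ℕ}

/-- A smooth chart of a subset `W` of a normed space with values in the half-space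
`{x | 0 ≤ x 0}`. The chart map `toFun` and its inverse `invFun` are given by smooth maps on open
subsets of the ambient spaces; they are inverse to each other between `W ∩ source` and the part of
`target` in the half-space. -/
structure HalfSpaceChart (W : Set V) (n : ℕ) where
  toFun : V → EuclideanSpace ℝ (Fin (n + 1))
  invFun : EuclideanSpace ℝ (Fin (n + 1)) → V
  source : Set V
  target : Set (EuclideanSpace ℝ (Fin (n + 1)))
  isOpen_source : IsOpen source
  isOpen_target : IsOpen target
  contDiffOn_toFun : ContDiffOn ℝ ∞ toFun source
  contDiffOn_invFun : ContDiffOn ℝ ∞ invFun target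
  map_source : ∀ w ∈ W, w ∈ source → toFun w ∈ target ∧ 0 ≤ toFun w 0
  map_target : ∀ x ∈ target, 0 ≤ x 0 → invFun x ∈ W ∧ invFun x ∈ source
  left_inv : ∀ w ∈ W, w ∈ source → invFun (toFun w) = w
  right_inv : ∀ x ∈ target, 0 ≤ x 0 → toFun (invFun x) = x

namespace HalfSpaceChart

variable {W : Set V}

lemma halfSpace_symm_coe {x : EuclideanSpace ℝ (Fin (n + 1))} (hx : 0 ≤ x 0) :
    ((𝓡∂ (n + 1)).symm x).1 = x :=
  (𝓡∂ (n + 1)).right_inv (by rw [range_modelWithCornersEuclideanHalfSpace]; exact hx)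

/-- The chart of the subtype `W` defined by a half-space chart. The point `w₀` is the value of the
inverse at the points outside the target. -/
def toOpenPartialHomeomorph (φ : HalfSpaceChart W n) (w₀ : W) :
    OpenPartialHomeomorph W (EuclideanHalfSpace (n + 1)) := by
  classical
  exact
  { toFun := fun w => (𝓡∂ (n + 1)).symm (φ.toFun w)
    invFun := fun x => if h : φ.invFun x.1 ∈ W then ⟨φ.invFun x.1, h⟩ else w₀
    source := {w | w.1 ∈ φ.source}
    target := {x | x.1 ∈ φ.target}
    map_source' := fun w hw => by
      have h := φ.map_source w.1 w.2 hw
      rw [mem_ofPred_eq, halfSpace_symm_coe h.2]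
      exact h.1
    map_target' := fun x hx => by
      have h := φ.map_target x.1 hx x.2
      simp only [mem_ofPred_eq, dif_pos h.1, h.2]
    left_inv' := fun w hw => by
      have h := φ.map_source w.1 w.2 hw
      simp only [halfSpace_symm_coe h.2, φ.left_inv w.1 w.2 hw, Subtype.coe_prop, dite_true,
        Subtype.coe_eta]
    right_inv' := fun x hx => by
      have h := φ.map_target x.1 hx x.2
      simp only [dif_pos h.1, φ.right_inv x.1 hx x.2]
      exact (𝓡∂ (n + 1)).left_inv x
    open_source := φ.isOpen_source.preimage continuous_subtype_val
    open_target := φ.isOpen_target.preimage continuous_subtype_val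
    continuousOn_toFun := (𝓡∂ (n + 1)).continuous_symm.comp_continuousOn
      (φ.contDiffOn_toFun.continuousOn.comp continuous_subtype_val.continuousOn fun _ hw => hw)
    continuousOn_invFun := by
      rw [Topology.IsInducing.subtypeVal.continuousOn_iff]
      refine (φ.contDiffOn_invFun.continuousOn.comp continuous_subtype_val.continuousOn
        fun _ hx => hx).congr fun x hx => ?_
      have h := φ.map_target x.1 hx x.2
      simp only [Function.comp_apply, dif_pos h.1] }

variable (φ ψ : HalfSpaceChart W n) (w₀ : W)

lemma toOpenPartialHomeomorph_coe {w : W} (hw : w.1 ∈ φ.source) :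
    (φ.toOpenPartialHomeomorph w₀ w).1 = φ.toFun w :=
  halfSpace_symm_coe (φ.map_source w.1 w.2 hw).2

lemma toOpenPartialHomeomorph_symm_coe {x : EuclideanSpace ℝ (Fin (n + 1))}
    (hx : x ∈ φ.target) (hx0 : 0 ≤ x 0) :
    ((φ.toOpenPartialHomeomorph w₀).symm ((𝓡∂ (n + 1)).symm x)).1 = φ.invFun x := by
  have h := φ.map_target x hx hx0
  rw [← halfSpace_symm_coe hx0] at h
  exact (congrArg Subtype.val (dif_pos h.1)).trans (congrArg φ.invFun (halfSpace_symm_coe hx0))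

lemma transition_eqOn :
    EqOn ((𝓡∂ (n + 1)) ∘ ((φ.toOpenPartialHomeomorph w₀).symm ≫ₕ ψ.toOpenPartialHomeomorph w₀) ∘
      (𝓡∂ (n + 1)).symm) (ψ.toFun ∘ φ.invFun)
      ({x | x ∈ φ.target ∧ φ.invFun x ∈ ψ.source} ∩ range (𝓡∂ (n + 1))) := by
  rintro x ⟨⟨hx, hx'⟩, hx0⟩
  rw [range_modelWithCornersEuclideanHalfSpace] at hx0
  have h := φ.toOpenPartialHomeomorph_symm_coe w₀ hx hx0
  exact (ψ.toOpenPartialHomeomorph_coe w₀ (h ▸ hx')).trans (congrArg ψ.toFun h)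

lemma contDiffOn_transition :
    ContDiffOn ℝ ∞ (ψ.toFun ∘ φ.invFun) {x | x ∈ φ.target ∧ φ.invFun x ∈ ψ.source} :=
  ψ.contDiffOn_toFun.comp (φ.contDiffOn_invFun.mono fun _ h => h.1) fun _ h => h.2

lemma isOpen_transition : IsOpen {x | x ∈ φ.target ∧ φ.invFun x ∈ ψ.source} :=
  φ.contDiffOn_invFun.continuousOn.isOpen_inter_preimage φ.isOpen_target ψ.isOpen_source

lemma differentiableAt_transition {x : EuclideanSpace ℝ (Fin (n + 1))} (hx : x ∈ φ.target)
    (hx' : φ.invFun x ∈ ψ.source) : DifferentiableAt ℝ (ψ.toFun ∘ φ.invFun) x :=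
  ((φ.contDiffOn_transition ψ).contDiffAt
    ((φ.isOpen_transition ψ).mem_nhds ⟨hx, hx'⟩)).differentiableAt (by simp)

/-- At an interior point the derivatives of a coordinate change and of its inverse are inverse to
each other, so the product of their determinants is `1`. -/
lemma det_fderiv_transition_mul {x : EuclideanSpace ℝ (Fin (n + 1))} (hx : x ∈ φ.target)
    (hx' : φ.invFun x ∈ ψ.source) (hx0 : 0 < x 0) :
    (fderiv ℝ (φ.toFun ∘ ψ.invFun) (ψ.toFun (φ.invFun x))).det *
      (fderiv ℝ (ψ.toFun ∘ φ.invFun) x).det = 1 := by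
  have hW := φ.map_target x hx hx0.le
  have h1 := ψ.map_source _ hW.1 hx'
  have e : (φ.toFun ∘ ψ.invFun) ∘ (ψ.toFun ∘ φ.invFun) =ᶠ[𝓝 x] id := by
    have ho : IsOpen {x : EuclideanSpace ℝ (Fin (n + 1)) | 0 < x 0} :=
      isOpen_lt continuous_const (by fun_prop)
    filter_upwards [(φ.isOpen_transition ψ).mem_nhds ⟨hx, hx'⟩, ho.mem_nhds hx0] with y hy hy0
    have hy0 : 0 ≤ y 0 := le_of_lt hy0
    have hyW := φ.map_target y hy.1 hy0
    simp only [Function.comp_apply, ψ.left_inv _ hyW.1 hy.2, φ.right_inv y hy.1 hy0, id]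
  have d1 := φ.differentiableAt_transition ψ hx hx'
  have d2 : DifferentiableAt ℝ (φ.toFun ∘ ψ.invFun) ((ψ.toFun ∘ φ.invFun) x) :=
    ψ.differentiableAt_transition φ h1.1 (by
      rw [Function.comp_apply, ψ.left_inv _ hW.1 hx']; exact hW.2)
  have h := e.fderiv_eq (𝕜 := ℝ)
  rw [fderiv_comp x d2 d1, fderiv_id] at h
  have h' := congrArg (fun L : EuclideanSpace ℝ (Fin (n + 1)) →L[ℝ] _ => L.det) h
  simpa only [ContinuousLinearMap.det, ContinuousLinearMap.toLinearMap_comp, LinearMap.det_comp,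
    ContinuousLinearMap.coe_id, LinearMap.det_id, Function.comp_apply] using h'

variable {ι : Type*} (φ : ι → HalfSpaceChart W n) (w₀ : W)
  (hcov : ∀ w : W, ∃ i, w.1 ∈ (φ i).source)

/-- The charted space structure on `W` defined by a covering family of half-space charts. -/
@[reducible]
def chartedSpace : ChartedSpace (EuclideanHalfSpace (n + 1)) W where
  atlas := range fun i => (φ i).toOpenPartialHomeomorph w₀
  chartAt w := (φ (hcov w).choose).toOpenPartialHomeomorph w₀
  mem_chart_source w := (hcov w).choose_spec
  chart_mem_atlas _ := mem_range_self _

lemma isManifold :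
    letI := chartedSpace φ w₀ hcov
    IsManifold (𝓡∂ (n + 1)) ∞ W := by
  let := chartedSpace φ w₀ hcov
  refine isManifold_of_contDiffOn _ _ _ ?_
  rintro _ _ ⟨i, rfl⟩ ⟨j, rfl⟩
  have hsub : (𝓡∂ (n + 1)).symm ⁻¹' (((φ i).toOpenPartialHomeomorph w₀).symm ≫ₕ
      (φ j).toOpenPartialHomeomorph w₀).source ∩ range (𝓡∂ (n + 1)) ⊆
      {x | x ∈ (φ i).target ∧ (φ i).invFun x ∈ (φ j).source} ∩ range (𝓡∂ (n + 1)) := by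
    rintro x ⟨⟨hx, hx'⟩, hx0⟩
    refine ⟨?_, hx0⟩
    rw [range_modelWithCornersEuclideanHalfSpace] at hx0
    have hx : x ∈ (φ i).target := by
      have : ((𝓡∂ (n + 1)).symm x).1 ∈ (φ i).target := hx
      rwa [halfSpace_symm_coe hx0] at this
    refine ⟨hx, ?_⟩
    have : (((φ i).toOpenPartialHomeomorph w₀).symm ((𝓡∂ (n + 1)).symm x)).1 ∈ (φ j).source := hx'
    rwa [(φ i).toOpenPartialHomeomorph_symm_coe w₀ hx hx0] at this
  exact ((((φ i).contDiffOn_transition (φ j)).mono inter_subset_left).congr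
    ((φ i).transition_eqOn (φ j) w₀)).mono hsub

/-- A family of half-space charts whose coordinate changes have positive Jacobian determinants is an
oriented atlas. -/
def orientedAtlas
    (hdet : ∀ i j, ∀ x ∈ (φ i).target, 0 ≤ x 0 → (φ i).invFun x ∈ (φ j).source →
      0 < (fderiv ℝ ((φ j).toFun ∘ (φ i).invFun) x).det) :
    letI := chartedSpace φ w₀ hcov
    OrientedAtlas (𝓡∂ (n + 1)) W :=
  letI := chartedSpace φ w₀ hcov
  haveI := isManifold φ w₀ hcov
  { charts := range fun i => (φ i).toOpenPartialHomeomorph w₀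
    smooth := IsManifold.subset_maximalAtlas
    covers := fun w => ⟨_, mem_range_self _, (hcov w).choose_spec⟩
    det_pos := by
      rintro _ ⟨i, rfl⟩ _ ⟨j, rfl⟩ w ⟨hw, hw'⟩
      have hw : w.1 ∈ (φ i).source := hw
      have hw' : w.1 ∈ (φ j).source := hw'
      obtain ⟨hx, hx0⟩ := (φ i).map_source w.1 w.2 hw
      have hl := (φ i).left_inv w.1 w.2 hw
      have hx' : (φ i).invFun ((φ i).toFun w) ∈ (φ j).source := by rwa [hl]
      have hd := (φ i).differentiableAt_transition (φ j) hx hx'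
      have hxr : (φ i).toFun w ∈ range (𝓡∂ (n + 1)) := by
        rw [range_modelWithCornersEuclideanHalfSpace]; exact hx0
      have hxe : ((φ i).toOpenPartialHomeomorph w₀).extend (𝓡∂ (n + 1)) w = (φ i).toFun w :=
        (φ i).toOpenPartialHomeomorph_coe w₀ hw
      have heq := (φ i).transition_eqOn (φ j) w₀
      have hmem := ((φ i).isOpen_transition (φ j)).mem_nhds ⟨hx, hx'⟩
      rw [hxe]
      -- The coordinate change extends smoothly across the boundary, and the half-space has unique
      -- differentials, so the derivative within the half-space is the full derivative.
      have : fderivWithin ℝ (((φ j).toOpenPartialHomeomorph w₀).extend (𝓡∂ (n + 1)) ∘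
          (((φ i).toOpenPartialHomeomorph w₀).extend (𝓡∂ (n + 1))).symm) (range (𝓡∂ (n + 1)))
          ((φ i).toFun w) = fderiv ℝ ((φ j).toFun ∘ (φ i).invFun) ((φ i).toFun w) := by
        rw [← hd.fderivWithin ((𝓡∂ (n + 1)).uniqueDiffOn _ hxr)]
        refine Filter.EventuallyEq.fderivWithin_eq ?_ (heq ⟨⟨hx, hx'⟩, hxr⟩)
        filter_upwards [mem_nhdsWithin_of_mem_nhds hmem, self_mem_nhdsWithin] with y hy hyr
        exact heq ⟨hy, hyr⟩
      rw [this]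
      exact hdet i j _ hx hx0 hx' }

/-- A criterion for boundary points. It asks for all charts around `w`, because the preferred chart
at `w` is an arbitrary choice. -/
lemma mem_boundary_iff (w : W) (p : Prop)
    (h : ∀ i, w.1 ∈ (φ i).source → ((φ i).toFun w 0 = 0 ↔ p)) :
    letI := chartedSpace φ w₀ hcov
    w ∈ (𝓡∂ (n + 1)).boundary W ↔ p := by
  let := chartedSpace φ w₀ hcov
  have hw := (hcov w).choose_spec
  rw [← h _ hw, ← (φ (hcov w).choose).toOpenPartialHomeomorph_coe w₀ hw]
  change extChartAt (𝓡∂ (n + 1)) w w ∈ frontier (range (𝓡∂ (n + 1))) ↔ _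
  rw [frontier_range_modelWithCornersEuclideanHalfSpace]
  exact eq_comm

end HalfSpaceChart

end HalfSpaceChart

namespace DiscBundle

open Set ComplexConjugate

variable {m : ℕ}

/-! ### Real coordinates on complex vectors -/

/-- The complex vectors in `ℂᵐ⁺¹`. -/
abbrev CVec (m : ℕ) : Type := Fin (m + 1) → ℂ

/-- The real vectors in `ℝ²ᵐ⁺²`, with the Euclidean norm. -/
abbrev RealVec (m : ℕ) : Type := EuclideanSpace ℝ (Fin (2 * m + 1 + 1))

/-- Splitting a real index of `ℝ²ᵐ⁺² = ℂᵐ⁺¹` into the index of a complex coordinate and the choice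
of its real (`0`) or imaginary (`1`) part. -/
def idx (m : ℕ) : Fin (2 * m + 1 + 1) ≃ Fin (m + 1) × Fin 2 :=
  (finCongr (by ring)).trans finProdFinEquiv.symm

lemma idx_zero : idx m 0 = (0, 0) := by
  rw [← Equiv.eq_symm_apply]
  ext
  simp [idx]

/-- The unit `κ` for which `re (κ z)` is the real part (for `0`) or the imaginary part (for `1`)
of `z`. -/
def partUnit : Fin 2 → ℂ := ![1, -Complex.I]

/-- The real coordinates of a complex vector: real and imaginary parts in turn. -/
def realCoord (m : ℕ) : CVec m ≃L[ℝ] RealVec m :=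
  LinearEquiv.toContinuousLinearEquiv
  { toFun := fun z => WithLp.toLp 2 fun i => (partUnit (idx m i).2 * z (idx m i).1).re
    invFun := fun v l => ⟨v ((idx m).symm (l, 0)), v ((idx m).symm (l, 1))⟩
    map_add' := fun z w => by ext i; simp [mul_add]
    map_smul' := fun r z => by
      ext i
      simp only [Pi.smul_apply, Complex.real_smul, RingHom.id_apply, PiLp.smul_apply, smul_eq_mul]
      rw [mul_left_comm, Complex.re_ofReal_mul]
    left_inv := fun z => by
      ext l
      apply Complex.ext <;> simp [partUnit]
    right_inv := fun v => by
      ext i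
      obtain ⟨p, rfl⟩ := (idx m).symm.surjective i
      obtain ⟨l, e⟩ := p
      fin_cases e <;> simp [partUnit] }

lemma realCoord_apply (z : CVec m) (i : Fin (2 * m + 1 + 1)) :
    realCoord m z i = (partUnit (idx m i).2 * z (idx m i).1).re := rfl

lemma realCoord_zero (z : CVec m) : realCoord m z 0 = (z 0).re := by
  simp [realCoord_apply, idx_zero, partUnit]

/-- The squared Hermitian norm of a complex vector. -/
def nsq (z : CVec m) : ℝ := ∑ l, Complex.normSq (z l)

lemma normSq_le_nsq (z : CVec m) (l : Fin (m + 1)) : Complex.normSq (z l) ≤ nsq z :=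
  Finset.single_le_sum (f := fun l => Complex.normSq (z l)) (fun _ _ => Complex.normSq_nonneg _)
    (Finset.mem_univ l)

lemma nsq_nonneg (z : CVec m) : 0 ≤ nsq z :=
  Finset.sum_nonneg fun _ _ => Complex.normSq_nonneg _

lemma nsq_pos {z : CVec m} (hz : z ≠ 0) : 0 < nsq z := by
  obtain ⟨l, hl⟩ := Function.ne_iff.1 hz
  exact (Complex.normSq_pos.2 hl).trans_le (normSq_le_nsq z l)

lemma nsq_smul (a : ℂ) (z : CVec m) : nsq (a • z) = Complex.normSq a * nsq z := by
  simp [nsq, Finset.mul_sum]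

lemma contDiff_nsq : ContDiff ℝ ∞ (nsq : CVec m → ℝ) := by
  refine ContDiff.sum fun l _ => ?_
  have h : ContDiff ℝ ∞ fun z : CVec m => z l := contDiff_apply ℝ ℂ l
  have h1 := Complex.reCLM.contDiff.comp h
  have h2 := Complex.imCLM.contDiff.comp h
  exact (h1.mul h1).add (h2.mul h2)

/-! ### The disc bundle -/

/-- The space of pairs of complex matrices. -/
abbrev MatrixPair (m : ℕ) : Type :=
  (Fin (m + 1) → CVec m) × (Fin (m + 1) → CVec m)

/-- The orthogonal projection onto the line of `z`, paired with the element `t • z ⊗ z` of the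
tensor square of this line. -/
def lineTensor (z : CVec m) (t : ℂ) : MatrixPair m :=
  (fun j k => z j * conj (z k) / nsq z, fun j k => t * (z j * z k))

/-- The unit disc bundle of the tensor square of the tautological line bundle over complex
projective space, embedded in pairs of matrices: a line is encoded by its orthogonal projection. -/
def discBundle (m : ℕ) : Set (MatrixPair m) :=
  {w | ∃ u c, nsq u = 1 ∧ ‖c‖ ≤ 1 ∧ lineTensor u c = w}

/-- Rescaling the vector that spans the line amounts to a change of the fibre coordinate. -/
lemma lineTensor_smul {a : ℂ} (ha : a ≠ 0) (z : CVec m) (t : ℂ) :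
    lineTensor (a • z) t = lineTensor z (a ^ 2 * t) := by
  ext j k
  · simp only [lineTensor, nsq_smul, Pi.smul_apply, smul_eq_mul, map_mul, Complex.ofReal_mul]
    have h : (Complex.normSq a : ℂ) ≠ 0 := by simpa using ha
    rw [← mul_div_mul_left _ (nsq z : ℂ) h]
    congr 1
    rw [← Complex.mul_conj]
    ring
  · simp only [lineTensor, Pi.smul_apply, smul_eq_mul]
    ring

lemma lineTensor_mem {z : CVec m} (hz : z ≠ 0) {t : ℂ} (ht : ‖t‖ * nsq z ≤ 1) :
    lineTensor z t ∈ discBundle m := by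
  have hn := nsq_pos hz
  have hs : (√(nsq z) : ℂ) ≠ 0 := by exact_mod_cast (Real.sqrt_pos.2 hn).ne'
  have hsq : (√(nsq z) : ℂ) ^ 2 = nsq z := by exact_mod_cast Real.sq_sqrt hn.le
  refine ⟨(√(nsq z) : ℂ)⁻¹ • z, t * nsq z, ?_, ?_, ?_⟩
  · rw [nsq_smul, map_inv₀, Complex.normSq_ofReal, Real.mul_self_sqrt hn.le,
      inv_mul_cancel₀ hn.ne']
  · rwa [norm_mul, Complex.norm_real, Real.norm_of_nonneg hn.le]
  · rw [lineTensor_smul (inv_ne_zero hs), inv_pow, hsq]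
    congr 1
    have : (nsq z : ℂ) ≠ 0 := by exact_mod_cast hn.ne'
    field_simp

lemma exists_lineTensor_eq {w : MatrixPair m} (hw : w ∈ discBundle m) :
    ∃ z t, z ≠ 0 ∧ ‖t‖ * nsq z ≤ 1 ∧ lineTensor z t = w := by
  obtain ⟨u, c, hu, hc, rfl⟩ := hw
  refine ⟨u, c, ?_, by rwa [hu, mul_one], rfl⟩
  rintro rfl
  simp [nsq] at hu

/-- Away from the zero section a point of the disc bundle is the square of a vector. -/
lemma exists_lineTensor_one_eq {w : MatrixPair m} (hw : w ∈ discBundle m) (h0 : w.2 ≠ 0) :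
    ∃ z, z ≠ 0 ∧ nsq z ≤ 1 ∧ lineTensor z 1 = w := by
  obtain ⟨z, t, hz, ht, rfl⟩ := exists_lineTensor_eq hw
  obtain ⟨d, rfl⟩ := IsAlgClosed.exists_pow_nat_eq t two_pos
  have hd0 : d ≠ 0 := by
    rintro rfl
    exact h0 (by ext; simp [lineTensor])
  refine ⟨d • z, smul_ne_zero hd0 hz, ?_, ?_⟩
  · rwa [nsq_smul, Complex.normSq_eq_norm_sq, ← norm_pow]
  · rw [lineTensor_smul hd0, mul_one]

lemma continuousOn_lineTensor :
    ContinuousOn (fun p : (CVec m) × ℂ => lineTensor p.1 p.2) {p | nsq p.1 = 1} := by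
  have hc : Continuous fun p : (CVec m) × ℂ =>
      ((fun j k => p.1 j * conj (p.1 k), fun j k => p.2 * (p.1 j * p.1 k)) : MatrixPair m) := by
    fun_prop
  refine hc.continuousOn.congr fun p hp => ?_
  have hp : nsq p.1 = 1 := hp
  simp [lineTensor, hp]

lemma isCompact_discBundle (m : ℕ) : IsCompact (discBundle m) := by
  have hK : IsCompact ({u : CVec m | nsq u = 1} ×ˢ Metric.closedBall (0 : ℂ) 1) := by
    refine IsCompact.prod ?_ (isCompact_closedBall _ _)
    refine (isCompact_closedBall (0 : CVec m) 1).of_isClosed_subset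
      (isClosed_eq contDiff_nsq.continuous continuous_const) fun u hu => ?_
    rw [mem_closedBall_zero_iff, pi_norm_le_iff_of_nonneg zero_le_one]
    intro l
    have h := normSq_le_nsq u l
    rw [show nsq u = 1 from hu, Complex.normSq_eq_norm_sq] at h
    nlinarith [norm_nonneg (u l)]
  convert hK.image_of_continuousOn (continuousOn_lineTensor.mono fun p hp => hp.1) using 1
  ext w
  constructor
  · rintro ⟨u, c, hu, hc, rfl⟩
    exact ⟨(u, c), ⟨hu, by simpa using hc⟩, rfl⟩
  · rintro ⟨⟨u, c⟩, ⟨hu, hc⟩, rfl⟩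
    exact ⟨u, c, hu, by simpa using hc, rfl⟩

lemma contDiffOn_complex_div {X : Type*} [NormedAddCommGroup X] [NormedSpace ℝ X] {s : Set X}
    {f g : X → ℂ} (hf : ContDiffOn ℝ ∞ f s) (hg : ContDiffOn ℝ ∞ g s) (h0 : ∀ x ∈ s, g x ≠ 0) :
    ContDiffOn ℝ ∞ (fun x => f x / g x) s := by
  simp only [div_eq_mul_inv]
  exact hf.mul (hg.inv h0)

lemma contDiffOn_lineTensor {X : Type*} [NormedAddCommGroup X] [NormedSpace ℝ X] {s : Set X}
    {z : X → CVec m} {t : X → ℂ} (hz : ContDiffOn ℝ ∞ z s) (ht : ContDiffOn ℝ ∞ t s)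
    (h0 : ∀ x ∈ s, z x ≠ 0) : ContDiffOn ℝ ∞ (fun x => lineTensor (z x) (t x)) s := by
  have hzj (j) : ContDiffOn ℝ ∞ (fun x => z x j) s := contDiffOn_pi.1 hz j
  refine ContDiffOn.prodMk ?_ ?_
  · refine contDiffOn_pi.2 fun j => contDiffOn_pi.2 fun k => ?_
    refine contDiffOn_complex_div
      ((hzj j).mul (Complex.conjCLE.contDiff.comp_contDiffOn (hzj k)))
      (Complex.ofRealCLM.contDiff.comp_contDiffOn (contDiff_nsq.comp_contDiffOn hz)) fun x hx => ?_
    exact_mod_cast (nsq_pos (h0 x hx)).ne'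
  · exact contDiffOn_pi.2 fun j => contDiffOn_pi.2 fun k => ht.mul ((hzj j).mul (hzj k))

/-! ### Bundle charts -/

/-- The translation that moves the bundle charts into the interior of the half-space: the fibre
coordinate has absolute value less than `1`, so its real part plus `2` is positive. -/
def shift (m : ℕ) : RealVec m := EuclideanSpace.single 0 2

/-- The complex coordinates of the bundle over the `l`-th affine chart of projective space: first
the fibre coordinate, then the affine coordinates. -/
def bundleCoord (l : Fin (m + 1)) (w : MatrixPair m) : CVec m :=
  Fin.cons (w.2 l l) fun j => w.1 (l.succAbove j) l / w.1 l l

/-- The homogeneous vector with `l`-th coordinate `1` and the other ones taken from the affine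
coordinates in `p`. -/
def homVec (l : Fin (m + 1)) (p : CVec m) : CVec m :=
  l.insertNth 1 (Fin.tail p)

lemma homVec_ne_zero (l : Fin (m + 1)) (p : CVec m) : homVec l p ≠ 0 := fun h => by
  simpa [homVec] using congrFun h l

lemma one_le_nsq_homVec (l : Fin (m + 1)) (p : CVec m) : 1 ≤ nsq (homVec l p) := by
  simpa [homVec] using normSq_le_nsq (homVec l p) l

lemma contDiff_homVec (l : Fin (m + 1)) {𝕜 : Type*} [RCLike 𝕜] [NormedAlgebra 𝕜 ℂ] :
    ContDiff 𝕜 ∞ (homVec l) := by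
  refine contDiff_pi.2 fun j => ?_
  induction j using l.succAboveCases with
  | x => simpa [homVec] using contDiff_const
  | p j => simpa [homVec, Fin.tail] using contDiff_apply 𝕜 ℂ j.succ

lemma bundleCoord_lineTensor {l : Fin (m + 1)} {z : CVec m} (hz : z l ≠ 0) (t : ℂ) :
    bundleCoord l (lineTensor z t) =
      Fin.cons (t * z l ^ 2) fun j => z (l.succAbove j) / z l := by
  have hn : (nsq z : ℂ) ≠ 0 := by
    exact_mod_cast (nsq_pos (fun h => hz (congrFun h l))).ne'
  have hc : conj (z l) ≠ 0 := by simpa using hz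
  simp only [bundleCoord, lineTensor, sq]
  congr 1
  funext j
  field_simp

lemma bundleCoord_lineTensor_homVec (l : Fin (m + 1)) (p : CVec m) :
    bundleCoord l (lineTensor (homVec l p) (p 0)) = p := by
  rw [bundleCoord_lineTensor (by simp [homVec])]
  funext j
  induction j using Fin.cases <;> simp [homVec, Fin.tail]

lemma homVec_cons (l : Fin (m + 1)) {z : CVec m} (hz : z l ≠ 0) (s : ℂ) :
    homVec l (Fin.cons s fun j => z (l.succAbove j) / z l) = (z l)⁻¹ • z := by
  funext j
  induction j using l.succAboveCases with
  | x => simp [homVec, hz]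
  | p j => simp [homVec, div_eq_inv_mul]

lemma ne_zero_of_mem_source {l : Fin (m + 1)} {z : CVec m} {t : ℂ}
    (h : ‖(lineTensor z t).2 l l‖ < ((lineTensor z t).1 l l).re) : z l ≠ 0 := by
  intro h0
  simp [lineTensor, h0] at h

/-- The condition defining the source of a bundle chart cuts out the open disc bundle. -/
lemma norm_mul_nsq_lt_one_of_mem_source {l : Fin (m + 1)} {z : CVec m} {t : ℂ}
    (h : ‖(lineTensor z t).2 l l‖ < ((lineTensor z t).1 l l).re) : ‖t‖ * nsq z < 1 := by
  have hzl := ne_zero_of_mem_source h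
  have hn := nsq_pos (z := z) fun h => hzl (congrFun h l)
  simp only [lineTensor] at h
  rw [Complex.mul_conj, ← Complex.ofReal_div, Complex.ofReal_re, Complex.normSq_eq_norm_sq,
    norm_mul, norm_mul, ← sq, lt_div_iff₀ hn] at h
  have hzl2 : 0 < ‖z l‖ ^ 2 := by positivity
  by_contra! h1
  nlinarith

/-- The chart of the open disc bundle over the `l`-th affine chart of projective space. -/
def bundleChart (l : Fin (m + 1)) : HalfSpaceChart (discBundle m) (2 * m + 1) where
  toFun w := realCoord m (bundleCoord l w) + shift m
  invFun x := lineTensor (homVec l ((realCoord m).symm (x - shift m)))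
    ((realCoord m).symm (x - shift m) 0)
  source := {w | ‖w.2 l l‖ < (w.1 l l).re}
  target := {x | ‖(realCoord m).symm (x - shift m) 0‖ *
    nsq (homVec l ((realCoord m).symm (x - shift m))) < 1}
  isOpen_source := isOpen_lt (by fun_prop) (by fun_prop)
  isOpen_target := isOpen_lt (Continuous.mul (by fun_prop)
    (contDiff_nsq.continuous.comp ((contDiff_homVec l (𝕜 := ℝ)).continuous.comp (by fun_prop))))
    continuous_const
  contDiffOn_toFun := by
    refine ContDiffOn.add ?_ contDiffOn_const
    refine (realCoord m).contDiff.comp_contDiffOn (contDiffOn_pi.2 fun j => ?_)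
    have h1 (j k) : ContDiff ℝ ∞ fun w : MatrixPair m => w.1 j k := by fun_prop
    have h2 (j k) : ContDiff ℝ ∞ fun w : MatrixPair m => w.2 j k := by fun_prop
    induction j using Fin.cases with
    | zero => exact (h2 l l).contDiffOn
    | succ j =>
      refine contDiffOn_complex_div (h1 (l.succAbove j) l).contDiffOn (h1 l l).contDiffOn
        fun w hw h => ?_
      have hw : ‖w.2 l l‖ < (w.1 l l).re := hw
      rw [h] at hw
      exact (norm_nonneg _).not_gt hw
  contDiffOn_invFun := by
    have h : ContDiff ℝ ∞ fun x => (realCoord m).symm (x - shift m) :=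
      (realCoord m).symm.contDiff.comp (contDiff_id.sub contDiff_const)
    exact contDiffOn_lineTensor ((contDiff_homVec l).comp h).contDiffOn
      (contDiff_pi.1 h 0).contDiffOn fun _ _ => homVec_ne_zero _ _
  map_source := by
    intro w hw hs
    obtain ⟨z, t, hz, ht, rfl⟩ := exists_lineTensor_eq hw
    have hzl : z l ≠ 0 := ne_zero_of_mem_source hs
    have htn : ‖t‖ * nsq z < 1 := norm_mul_nsq_lt_one_of_mem_source hs
    have hmain : ‖t * z l ^ 2‖ * nsq ((z l)⁻¹ • z) < 1 := by
      rw [nsq_smul, map_inv₀, Complex.normSq_eq_norm_sq, norm_mul, norm_pow]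
      calc ‖t‖ * ‖z l‖ ^ 2 * ((‖z l‖ ^ 2)⁻¹ * nsq z) = ‖t‖ * nsq z := by field_simp
        _ < 1 := htn
    rw [bundleCoord_lineTensor hzl]
    refine ⟨?_, ?_⟩
    · rw [mem_ofPred_eq, add_sub_cancel_right, ContinuousLinearEquiv.symm_apply_apply,
        homVec_cons l hzl, Fin.cons_zero]
      exact hmain
    · have h1 := one_le_nsq_homVec l
        (Fin.cons (t * z l ^ 2) fun j => z (l.succAbove j) / z l)
      rw [homVec_cons l hzl] at h1
      have h2 : ‖t * z l ^ 2‖ ≤ 1 := by nlinarith [norm_nonneg (t * z l ^ 2)]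
      have h3 := (abs_le.1 ((Complex.abs_re_le_norm _).trans h2)).1
      rw [PiLp.add_apply, realCoord_zero, Fin.cons_zero, shift, PiLp.single_apply,
        if_pos rfl]
      linarith
  map_target := by
    intro x hx _
    refine ⟨lineTensor_mem (homVec_ne_zero _ _) (le_of_lt hx), ?_⟩
    have hn := nsq_pos (homVec_ne_zero l ((realCoord m).symm (x - shift m)))
    rw [mem_ofPred_eq] at hx
    rw [← lt_div_iff₀ hn] at hx
    have : homVec l ((realCoord m).symm (x - shift m)) l = 1 := by simp [homVec]
    simp only [mem_ofPred_eq, lineTensor, this]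
    simpa [← Complex.ofReal_inv] using hx
  left_inv := by
    intro w hw hs
    obtain ⟨z, t, hz, ht, rfl⟩ := exists_lineTensor_eq hw
    have hzl : z l ≠ 0 := ne_zero_of_mem_source hs
    rw [bundleCoord_lineTensor hzl, add_sub_cancel_right, ContinuousLinearEquiv.symm_apply_apply,
      homVec_cons l hzl, Fin.cons_zero, lineTensor_smul (inv_ne_zero hzl)]
    congr 1
    field_simp
  right_inv := by
    intro x _ _
    rw [bundleCoord_lineTensor_homVec, ContinuousLinearEquiv.apply_symm_apply, sub_add_cancel]

/-! ### Collar charts -/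

/-- The norm of the fibre part: on `lineTensor z 1` it is the squared norm of `z`. -/
def fibreNorm (w : MatrixPair m) : ℝ := √(∑ j, ∑ k, Complex.normSq (w.2 j k))

/-- The product of the `i`-th and the `j`-th real coordinate of a vector `z`, as a function of the
point `lineTensor z 1`. -/
def coordMul (i j : Fin (2 * m + 1 + 1)) (w : MatrixPair m) : ℝ :=
  (partUnit (idx m i).2 * partUnit (idx m j).2 * w.2 (idx m i).1 (idx m j).1 +
    partUnit (idx m i).2 * conj (partUnit (idx m j).2) *
      (fibreNorm w * w.1 (idx m i).1 (idx m j).1)).re / 2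

lemma fibreNorm_lineTensor (z : CVec m) (t : ℂ) : fibreNorm (lineTensor z t) = ‖t‖ * nsq z := by
  have h : ∑ j, ∑ k, Complex.normSq ((lineTensor z t).2 j k) = (‖t‖ * nsq z) ^ 2 := by
    simp only [lineTensor, map_mul, ← Finset.mul_sum, ← nsq.eq_def,
      Complex.normSq_eq_norm_sq t]
    rw [← Finset.sum_mul, ← nsq.eq_def]
    ring
  rw [fibreNorm, h, Real.sqrt_sq (mul_nonneg (norm_nonneg t) (nsq_nonneg z))]

lemma fibreNorm_lineTensor_one (z : CVec m) : fibreNorm (lineTensor z 1) = nsq z := by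
  rw [fibreNorm_lineTensor, norm_one, one_mul]

/-- Products of real parts are linear in `x * y` and `x * conj y`, which for coordinates of `z` are
read off from `z zᵀ` and `z z*`. -/
lemma re_mul_re (x y : ℂ) : x.re * y.re = (x * y + x * conj y).re / 2 := by
  simp

lemma coordMul_lineTensor_one {z : CVec m} (hz : z ≠ 0) (i j : Fin (2 * m + 1 + 1)) :
    coordMul i j (lineTensor z 1) = realCoord m z i * realCoord m z j := by
  have hn : (nsq z : ℂ) ≠ 0 := by exact_mod_cast (nsq_pos hz).ne'
  rw [realCoord_apply, realCoord_apply, re_mul_re, coordMul, fibreNorm_lineTensor_one]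
  simp only [lineTensor, map_mul]
  congr 2
  field_simp

/-- The collar coordinates: the defining function of the boundary, then the affine coordinates of
the real line through the vector that the point is the square of, multiplied by a sign `ε`. -/
def collarCoord (ε : ℝ) (i : Fin (2 * m + 1 + 1)) (w : MatrixPair m) :
    RealVec m :=
  WithLp.toLp 2 (Fin.cons (1 - fibreNorm w) fun j =>
    ε * (coordMul (i.succAbove j) i w / coordMul i i w))

/-- The collar coordinates of the square of the vector with real coordinates `v`. -/
def vectorCoord (ε : ℝ) (i : Fin (2 * m + 1 + 1)) (v : RealVec m) :
    RealVec m :=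
  WithLp.toLp 2 (Fin.cons (1 - nsq ((realCoord m).symm v)) fun j => ε * (v (i.succAbove j) / v i))

/-- The real homogeneous vector with `i`-th coordinate `1` and the other ones taken from the collar
coordinates. -/
def realHomVec (ε : ℝ) (i : Fin (2 * m + 1 + 1)) (x : RealVec m) :
    RealVec m :=
  WithLp.toLp 2 (i.insertNth (1 : ℝ) fun j => ε * x (Fin.succ j))

/-- The vector in direction `realHomVec ε i x` whose squared norm is `1 - x 0`. -/
def collarLift (ε : ℝ) (i : Fin (2 * m + 1 + 1)) (x : RealVec m) :
    RealVec m :=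
  √((1 - x 0) / nsq ((realCoord m).symm (realHomVec ε i x))) • realHomVec ε i x

/-- The inverse of the collar coordinates. -/
def collarInv (ε : ℝ) (i : Fin (2 * m + 1 + 1)) (x : RealVec m) :
    MatrixPair m :=
  lineTensor ((realCoord m).symm (realHomVec ε i x))
    (((1 - x 0) / nsq ((realCoord m).symm (realHomVec ε i x)) : ℝ) : ℂ)

variable {ε : ℝ} {i : Fin (2 * m + 1 + 1)}

lemma realHomVec_self (x : RealVec m) : realHomVec ε i x i = 1 := by
  simp [realHomVec]

lemma symm_realHomVec_ne_zero (x : RealVec m) :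
    (realCoord m).symm (realHomVec ε i x) ≠ 0 := by
  rw [Ne, EmbeddingLike.map_eq_zero_iff]
  intro h
  simpa [realHomVec_self] using congrArg (fun v => v i) h

lemma contDiff_realHomVec : ContDiff ℝ ∞ (realHomVec (m := m) ε i) := by
  refine contDiff_euclidean.2 fun j => ?_
  induction j using i.succAboveCases with
  | x => simpa [realHomVec] using contDiff_const
  | p j =>
    simp only [realHomVec, Fin.insertNth_apply_succAbove]
    fun_prop

lemma nsq_real_smul (r : ℝ) (z : CVec m) : nsq (r • z) = r ^ 2 * nsq z := by
  rw [← Complex.coe_smul, nsq_smul, Complex.normSq_ofReal, sq]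

lemma lineTensor_real_smul {r : ℝ} (hr : r ≠ 0) (z : CVec m) (t : ℂ) :
    lineTensor (r • z) t = lineTensor z ((r ^ 2 : ℝ) * t) := by
  rw [← Complex.coe_smul, lineTensor_smul (by exact_mod_cast hr), Complex.ofReal_pow]

lemma realHomVec_vectorCoord (hε : ε * ε = 1) {v : RealVec m}
    (hv : v i ≠ 0) (s : ℝ) :
    realHomVec ε i (WithLp.toLp 2 (Fin.cons s fun j => ε * (v (i.succAbove j) / v i))) =
      (v i)⁻¹ • v := by
  ext j
  induction j using i.succAboveCases with
  | x => simp [realHomVec, hv]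
  | p j => simp [realHomVec, ← mul_assoc, hε, div_eq_inv_mul]

lemma vectorCoord_smul_realHomVec (hε : ε * ε = 1) {r : ℝ} (hr : r ≠ 0)
    (x : RealVec m) (j : Fin (2 * m + 1)) :
    vectorCoord ε i (r • realHomVec ε i x) j.succ = x j.succ := by
  simp only [vectorCoord, Fin.cons_succ, PiLp.smul_apply, smul_eq_mul, realHomVec_self, mul_one]
  rw [mul_div_cancel_left₀ _ hr]
  simp [realHomVec, ← mul_assoc, hε]

lemma collarCoord_lineTensor_one {z : CVec m} (hz : realCoord m z i ≠ 0) :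
    collarCoord ε i (lineTensor z 1) = vectorCoord ε i (realCoord m z) := by
  have h0 : z ≠ 0 := by
    rintro rfl
    simp at hz
  simp only [collarCoord, vectorCoord, coordMul_lineTensor_one h0, fibreNorm_lineTensor_one,
    ContinuousLinearEquiv.symm_apply_apply, mul_div_mul_right _ _ hz]

lemma collarLift_scale_pos {x : RealVec m} (hx : x 0 < 1) :
    0 < (1 - x 0) / nsq ((realCoord m).symm (realHomVec ε i x)) :=
  div_pos (sub_pos.2 hx) (nsq_pos (symm_realHomVec_ne_zero x))

lemma collarLift_self_pos {x : RealVec m} (hx : x 0 < 1) :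
    0 < collarLift ε i x i := by
  simpa [collarLift, realHomVec_self] using
    Real.sqrt_pos.1 (Real.sqrt_pos.2 (collarLift_scale_pos hx))

lemma nsq_collarLift {x : RealVec m} (hx : x 0 < 1) :
    nsq ((realCoord m).symm (collarLift ε i x)) = 1 - x 0 := by
  rw [collarLift, map_smul, nsq_real_smul, Real.sq_sqrt (collarLift_scale_pos hx).le,
    div_mul_cancel₀ _ (nsq_pos (symm_realHomVec_ne_zero x)).ne']

lemma vectorCoord_collarLift (hε : ε * ε = 1) {x : RealVec m}
    (hx : x 0 < 1) : vectorCoord ε i (collarLift ε i x) = x := by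
  ext j
  induction j using Fin.cases with
  | zero =>
    simp only [vectorCoord, Fin.cons_zero, nsq_collarLift hx]
    ring
  | succ j =>
    exact vectorCoord_smul_realHomVec hε (Real.sqrt_pos.2 (collarLift_scale_pos hx)).ne' x j

lemma lineTensor_collarLift {x : RealVec m} (hx : x 0 < 1) :
    lineTensor ((realCoord m).symm (collarLift ε i x)) 1 = collarInv ε i x := by
  rw [collarLift, map_smul, lineTensor_real_smul (Real.sqrt_pos.2 (collarLift_scale_pos hx)).ne',
    Real.sq_sqrt (collarLift_scale_pos hx).le, mul_one, collarInv]

lemma contDiffOn_collarLift : ContDiffOn ℝ ∞ (collarLift (m := m) ε i) {x | x 0 < 1} := by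
  have h : ContDiff ℝ ∞ (realHomVec (m := m) ε i) := contDiff_realHomVec
  refine ContDiffOn.smul (ContDiffOn.sqrt (ContDiffOn.div ?_ ?_ ?_) ?_) h.contDiffOn
  · exact (contDiff_const.sub (by fun_prop)).contDiffOn
  · exact (contDiff_nsq.comp ((realCoord m).symm.contDiff.comp h)).contDiffOn
  · exact fun x _ => (nsq_pos (symm_realHomVec_ne_zero x)).ne'
  · exact fun x hx => (collarLift_scale_pos hx).ne'

lemma contDiffOn_fibreNorm : ContDiffOn ℝ ∞ (fibreNorm (m := m)) {w | w.2 ≠ 0} := by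
  refine ContDiffOn.sqrt (ContDiff.contDiffOn ?_) fun w hw => ?_
  · refine ContDiff.sum fun j _ => ContDiff.sum fun k _ => ?_
    have h : ContDiff ℝ ∞ fun w : MatrixPair m => w.2 j k := by fun_prop
    have h1 := Complex.reCLM.contDiff.comp h
    have h2 := Complex.imCLM.contDiff.comp h
    exact (h1.mul h1).add (h2.mul h2)
  · obtain ⟨j, hj⟩ := Function.ne_iff.1 hw
    obtain ⟨k, hk⟩ := Function.ne_iff.1 hj
    have hp : 0 < Complex.normSq (w.2 j k) := Complex.normSq_pos.2 hk
    refine (hp.trans_le ?_).ne'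
    exact (Finset.single_le_sum (f := fun k => Complex.normSq (w.2 j k))
      (fun _ _ => Complex.normSq_nonneg _) (Finset.mem_univ k)).trans
      (Finset.single_le_sum (f := fun j => ∑ k, Complex.normSq (w.2 j k))
        (fun _ _ => Finset.sum_nonneg fun _ _ => Complex.normSq_nonneg _) (Finset.mem_univ j))

lemma continuous_coordMul (i j : Fin (2 * m + 1 + 1)) : Continuous (coordMul (m := m) i j) := by
  have h : Continuous (fibreNorm (m := m)) := by
    unfold fibreNorm
    fun_prop
  unfold coordMul
  fun_prop

lemma contDiffOn_coordMul (i j : Fin (2 * m + 1 + 1)) :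
    ContDiffOn ℝ ∞ (coordMul (m := m) i j) {w | w.2 ≠ 0} := by
  have h1 (j k) : ContDiff ℝ ∞ fun w : MatrixPair m => w.1 j k := by fun_prop
  have h2 (j k) : ContDiff ℝ ∞ fun w : MatrixPair m => w.2 j k := by fun_prop
  refine ContDiffOn.div_const (Complex.reCLM.contDiff.comp_contDiffOn (ContDiffOn.add
    (contDiffOn_const.mul (h2 _ _).contDiffOn) (contDiffOn_const.mul (ContDiffOn.mul
      (Complex.ofRealCLM.contDiff.comp_contDiffOn contDiffOn_fibreNorm) (h1 _ _).contDiffOn)))) _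

lemma contDiffOn_collarCoord :
    ContDiffOn ℝ ∞ (collarCoord (m := m) ε i) {w | w.2 ≠ 0 ∧ coordMul i i w ≠ 0} := by
  refine contDiffOn_euclidean.2 fun j => ?_
  induction j using Fin.cases with
  | zero => exact (contDiffOn_const.sub contDiffOn_fibreNorm).mono fun _ h => h.1
  | succ j =>
    exact contDiffOn_const.mul (((contDiffOn_coordMul _ _).mono fun _ h => h.1).div
      ((contDiffOn_coordMul _ _).mono fun _ h => h.1) fun _ h => h.2)

lemma exists_of_mem_collar {w : MatrixPair m} (hw : w ∈ discBundle m)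
    (hs : w.2 ≠ 0 ∧ coordMul i i w ≠ 0) :
    ∃ z, nsq z ≤ 1 ∧ realCoord m z i ≠ 0 ∧ lineTensor z 1 = w := by
  obtain ⟨z, hz, hz1, rfl⟩ := exists_lineTensor_one_eq hw hs.1
  refine ⟨z, hz1, fun h => hs.2 ?_, rfl⟩
  rw [coordMul_lineTensor_one hz, h, zero_mul]

lemma lineTensor_one_mem_collar {z : CVec m} (hz : realCoord m z i ≠ 0) :
    (lineTensor z 1).2 ≠ 0 ∧ coordMul i i (lineTensor z 1) ≠ 0 := by
  have h0 : z ≠ 0 := by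
    rintro rfl
    simp at hz
  refine ⟨fun h => ?_, ?_⟩
  · obtain ⟨l, hl⟩ := Function.ne_iff.1 h0
    have h : 1 * (z l * z l) = 0 := congrFun (congrFun h l) l
    simp at h
    exact hl h
  · rw [coordMul_lineTensor_one h0]
    exact mul_ne_zero hz hz

/-- The chart of the disc bundle without the zero section, which is a collar of the boundary, over
the `i`-th affine chart of real projective space. -/
def collarChart (ε : ℝ) (hε : ε * ε = 1) (i : Fin (2 * m + 1 + 1)) :
    HalfSpaceChart (discBundle m) (2 * m + 1) where
  toFun := collarCoord ε i
  invFun := collarInv ε i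
  source := {w | w.2 ≠ 0 ∧ coordMul i i w ≠ 0}
  target := {x | x 0 < 1}
  isOpen_source := (isOpen_ne_fun continuous_snd continuous_const).inter
    (isOpen_ne_fun (continuous_coordMul i i) continuous_const)
  isOpen_target := isOpen_lt (by fun_prop) continuous_const
  contDiffOn_toFun := contDiffOn_collarCoord
  contDiffOn_invFun := by
    have h := (realCoord m).symm.contDiff.comp (contDiff_realHomVec (m := m) (ε := ε) (i := i))
    refine contDiffOn_lineTensor h.contDiffOn (Complex.ofRealCLM.contDiff.comp_contDiffOn
      (ContDiffOn.div (contDiff_const.sub (by fun_prop)).contDiffOn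
      (contDiff_nsq.comp h).contDiffOn ?_)) ?_
    · exact fun x _ => (nsq_pos (symm_realHomVec_ne_zero x)).ne'
    · exact fun x _ => symm_realHomVec_ne_zero x
  map_source := by
    intro w hw hs
    obtain ⟨z, hz1, hzi, rfl⟩ := exists_of_mem_collar hw hs
    have h0 : z ≠ 0 := by
      rintro rfl
      simp at hzi
    rw [collarCoord_lineTensor_one hzi]
    simp only [vectorCoord, mem_ofPred_eq, Fin.cons_zero, ContinuousLinearEquiv.symm_apply_apply]
    exact ⟨by linarith [nsq_pos h0], by linarith⟩
  map_target := by
    intro x hx hx0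
    have hx : x 0 < 1 := hx
    rw [← lineTensor_collarLift hx]
    have hi := collarLift_self_pos (ε := ε) (i := i) hx
    have hi' : realCoord m ((realCoord m).symm (collarLift ε i x)) i ≠ 0 := by
      rw [ContinuousLinearEquiv.apply_symm_apply]
      exact hi.ne'
    refine ⟨lineTensor_mem ?_ ?_, lineTensor_one_mem_collar hi'⟩
    · intro h
      simp [h] at hi'
    · rw [nsq_collarLift hx, norm_one, one_mul]
      linarith
  left_inv := by
    intro w hw hs
    obtain ⟨z, hz1, hzi, rfl⟩ := exists_of_mem_collar hw hs
    have h0 : z ≠ 0 := by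
      rintro rfl
      simp at hzi
    have hn := (nsq_pos h0).ne'
    rw [collarCoord_lineTensor_one hzi, collarInv, vectorCoord, realHomVec_vectorCoord hε hzi,
      map_smul, ContinuousLinearEquiv.symm_apply_apply, lineTensor_real_smul (inv_ne_zero hzi),
      nsq_real_smul]
    simp only [Fin.cons_zero]
    rw [← Complex.ofReal_mul, ← Complex.ofReal_one]
    congr 2
    field_simp
    ring
  right_inv := by
    intro x hx _
    have hx : x 0 < 1 := hx
    have hi := collarLift_self_pos (ε := ε) (i := i) hx
    rw [← lineTensor_collarLift hx, collarCoord_lineTensor_one,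
      ContinuousLinearEquiv.apply_symm_apply, vectorCoord_collarLift hε hx]
    rw [ContinuousLinearEquiv.apply_symm_apply]
    exact hi.ne'

/-! ### Orientation -/

lemma det_comp_euclidean {n : ℕ} (A B : EuclideanSpace ℝ (Fin n) →L[ℝ] EuclideanSpace ℝ (Fin n)) :
    (A ∘L B).det = A.det * B.det := by
  simp only [ContinuousLinearMap.det, ContinuousLinearMap.toLinearMap_comp, LinearMap.det_comp]

/-- A complex linear endomorphism has nonnegative real determinant, namely the squared absolute
value of its complex determinant. -/
lemma det_restrictScalars_nonneg (L : CVec m →L[ℂ] CVec m) :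
    0 ≤ ((realCoord m : CVec m →L[ℝ] RealVec m) ∘L L.restrictScalars ℝ ∘L
      ((realCoord m).symm : RealVec m →L[ℝ] CVec m)).det := by
  have h := LinearMap.det_conj ((L : CVec m →ₗ[ℂ] _).restrictScalars ℝ)
    (realCoord m).toLinearEquiv
  rw [LinearMap.det_restrictScalars, Algebra.norm_complex_apply] at h
  exact (Complex.normSq_nonneg _).trans_eq h.symm

/-- The derivative of a complex differentiable map followed by the shifted real coordinates. -/
lemma hasFDerivAt_realCoord_comp {h : CVec m → CVec m}
    {g : RealVec m → RealVec m}
    {x : RealVec m}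
    (hh : DifferentiableAt ℂ h ((realCoord m).symm (g x))) (hg : DifferentiableAt ℝ g x) :
    HasFDerivAt (fun y => realCoord m (h ((realCoord m).symm (g y))) + shift m)
      (((realCoord m : CVec m →L[ℝ] RealVec m) ∘L
        (fderiv ℂ h ((realCoord m).symm (g x))).restrictScalars ℝ ∘L
        ((realCoord m).symm : RealVec m →L[ℝ] CVec m)) ∘L fderiv ℝ g x) x := by
  have h1 := ((realCoord m).symm : RealVec m →L[ℝ] CVec m).hasFDerivAt.comp x hg.hasFDerivAt
  have h2 := (hh.hasFDerivAt.restrictScalars ℝ).comp x h1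
  exact (((realCoord m : CVec m →L[ℝ] RealVec m).hasFDerivAt.comp x h2).add_const _)

/-- The bundle coordinates of `lineTensor z t`, as written in `bundleCoord_lineTensor`, depend
holomorphically on `z` and `t`. -/
lemma differentiableAt_cons {X : Type*} [NormedAddCommGroup X] [NormedSpace ℂ X] {x : X}
    {l : Fin (m + 1)} {z : X → CVec m} {t : X → ℂ} (hz : DifferentiableAt ℂ z x)
    (ht : DifferentiableAt ℂ t x) (h0 : z x l ≠ 0) :
    DifferentiableAt ℂ (fun y => (Fin.cons (t y * z y l ^ 2) fun j =>
      z y (l.succAbove j) / z y l : CVec m)) x := by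
  have h := differentiableAt_pi.1 hz
  refine differentiableAt_pi.2 fun j => ?_
  induction j using Fin.cases with
  | zero => exact ht.mul ((h l).pow 2)
  | succ j =>
    simp only [Fin.cons_succ, div_eq_mul_inv]
    exact (h _).fun_mul ((h l).fun_inv h0)

lemma zero_lt_of_mem_bundleChart_target {l : Fin (m + 1)}
    {x : RealVec m} (hx : x ∈ (bundleChart l).target) : 0 < x 0 := by
  have hx : ‖(realCoord m).symm (x - shift m) 0‖ *
    nsq (homVec l ((realCoord m).symm (x - shift m))) < 1 := hx
  have h1 := one_le_nsq_homVec l ((realCoord m).symm (x - shift m))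
  have h2 : ‖(realCoord m).symm (x - shift m) 0‖ ≤ 1 := by
    nlinarith [norm_nonneg ((realCoord m).symm (x - shift m) 0)]
  have h3 := (abs_le.1 ((Complex.abs_re_le_norm _).trans h2)).1
  rw [← realCoord_zero, ContinuousLinearEquiv.apply_symm_apply, PiLp.sub_apply, shift,
    PiLp.single_apply, if_pos rfl] at h3
  linarith

lemma det_bundle_bundle_pos (l l' : Fin (m + 1)) {x : RealVec m}
    (hx : x ∈ (bundleChart l).target)
    (hx' : (bundleChart l).invFun x ∈ (bundleChart l').source) :
    0 < (fderiv ℝ ((bundleChart l').toFun ∘ (bundleChart l).invFun) x).det := by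
  -- The determinant is nonnegative because the coordinate change is holomorphic, and nonzero
  -- because the coordinate change is invertible.
  refine lt_of_le_of_ne ?_ ?_
  · have h0 : homVec l ((realCoord m).symm (x - shift m)) l' ≠ 0 :=
      ne_zero_of_mem_source hx'
    have hd : DifferentiableAt ℂ (homVec l) ((realCoord m).symm (x - shift m)) :=
      (contDiff_homVec l).contDiffAt.differentiableAt (by simp)
    have hc := differentiableAt_cons hd
      (t := fun p : CVec m => p 0) (by fun_prop) h0
    have hg : DifferentiableAt ℝ (fun y => y - shift m) x := by fun_prop
    have key := hasFDerivAt_realCoord_comp (g := fun y => y - shift m) hc hg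
    have key' := key.congr_of_eventuallyEq
      (f₁ := (bundleChart l').toFun ∘ (bundleChart l).invFun) (by
      filter_upwards [((bundleChart l).isOpen_transition (bundleChart l')).mem_nhds ⟨hx, hx'⟩]
        with y hy
      have hy' : homVec l ((realCoord m).symm (y - shift m)) l' ≠ 0 :=
        ne_zero_of_mem_source hy.2
      exact congrArg (fun p => realCoord m p + shift m) (bundleCoord_lineTensor hy' _))
    rw [key'.fderiv, det_comp_euclidean]
    refine mul_nonneg (det_restrictScalars_nonneg _) ?_
    rw [fderiv_sub_const, fderiv_fun_id]
    simp [ContinuousLinearMap.det]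
  · have h := (bundleChart l).det_fderiv_transition_mul (bundleChart l') hx hx'
      (zero_lt_of_mem_bundleChart_target hx)
    exact (right_ne_zero_of_mul (h ▸ one_ne_zero)).symm

lemma contDiffOn_vectorCoord (ε : ℝ) (i : Fin (2 * m + 1 + 1)) :
    ContDiffOn ℝ ∞ (vectorCoord (m := m) ε i) {v | v i ≠ 0} := by
  refine contDiffOn_euclidean.2 fun j => ?_
  induction j using Fin.cases with
  | zero => exact (contDiff_const.sub (contDiff_nsq.comp (realCoord m).symm.contDiff)).contDiffOn
  | succ j =>
    refine contDiffOn_const.mul (ContDiffOn.div ?_ ?_ fun v hv => hv) <;>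
    exact ContDiff.contDiffOn (by fun_prop)

lemma isOpen_coord_ne_zero (i : Fin (2 * m + 1 + 1)) :
    IsOpen {v : RealVec m | v i ≠ 0} :=
  isOpen_ne_fun (by fun_prop) continuous_const

lemma differentiableAt_vectorCoord {ε : ℝ} {i : Fin (2 * m + 1 + 1)}
    {v : RealVec m} (hv : v i ≠ 0) :
    DifferentiableAt ℝ (vectorCoord ε i) v :=
  ((contDiffOn_vectorCoord ε i).contDiffAt
    ((isOpen_coord_ne_zero i).mem_nhds hv)).differentiableAt (by simp)

lemma differentiableAt_collarLift {ε : ℝ} {i : Fin (2 * m + 1 + 1)}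
    {x : RealVec m} (hx : x 0 < 1) :
    DifferentiableAt ℝ (collarLift ε i) x :=
  (contDiffOn_collarLift.contDiffAt
    ((isOpen_lt (by fun_prop) continuous_const).mem_nhds hx)).differentiableAt (by simp)

/-- The map `collarLift` is a section of the collar coordinates, so their derivatives are inverse to
each other. -/
lemma det_vectorCoord_mul {ε : ℝ} (hε : ε * ε = 1) {i : Fin (2 * m + 1 + 1)}
    {x : RealVec m} (hx : x 0 < 1) :
    (fderiv ℝ (vectorCoord ε i) (collarLift ε i x)).det *
      (fderiv ℝ (collarLift ε i) x).det = 1 := by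
  have h := ((differentiableAt_vectorCoord (ε := ε)
    (collarLift_self_pos (ε := ε) (i := i) hx).ne').hasFDerivAt.comp x
    (differentiableAt_collarLift hx).hasFDerivAt)
  have e : vectorCoord ε i ∘ collarLift ε i =ᶠ[𝓝 x] id := by
    have ho : IsOpen {x : RealVec m | x 0 < 1} :=
      isOpen_lt (by fun_prop) continuous_const
    filter_upwards [ho.mem_nhds hx] with y hy
    exact vectorCoord_collarLift hε hy
  have h1 := (h.congr_of_eventuallyEq e.symm).unique (hasFDerivAt_id x)
  rw [← det_comp_euclidean, h1]
  simp [ContinuousLinearMap.det]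

lemma collarLift_vectorCoord {ε : ℝ} (hε : ε * ε = 1) {i : Fin (2 * m + 1 + 1)}
    {v : RealVec m} (hv : 0 < v i) :
    vectorCoord ε i v 0 < 1 ∧ collarLift ε i (vectorCoord ε i v) = v := by
  have h0 : (realCoord m).symm v ≠ 0 := by
    rw [Ne, EmbeddingLike.map_eq_zero_iff]
    rintro rfl
    simp at hv
  have hn := nsq_pos h0
  have hz : vectorCoord ε i v 0 = 1 - nsq ((realCoord m).symm v) := rfl
  refine ⟨by linarith, ?_⟩
  rw [collarLift, hz, vectorCoord, realHomVec_vectorCoord hε hv.ne', map_smul, nsq_real_smul,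
    sub_sub_cancel]
  have : nsq ((realCoord m).symm v) / ((v i)⁻¹ ^ 2 * nsq ((realCoord m).symm v)) = v i ^ 2 := by
    field_simp
  rw [this, Real.sqrt_sq hv.le, smul_inv_smul₀ hv.ne']

lemma det_vectorCoord_ne_zero {ε : ℝ} (hε : ε * ε = 1) {i : Fin (2 * m + 1 + 1)}
    {v : RealVec m} (hv : 0 < v i) :
    (fderiv ℝ (vectorCoord ε i) v).det ≠ 0 := by
  obtain ⟨h1, h2⟩ := collarLift_vectorCoord hε hv
  have h := det_vectorCoord_mul hε (i := i) h1
  rw [h2] at h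
  exact left_ne_zero_of_mul (h ▸ one_ne_zero)

/-- The collar coordinates of `v` and `-v` agree and the dimension is even, so the Jacobian
determinants at `v` and `-v` are equal. -/
lemma det_vectorCoord_neg (ε : ℝ) {i : Fin (2 * m + 1 + 1)} {v : RealVec m} (hv : v i ≠ 0) :
    (fderiv ℝ (vectorCoord ε i) (-v)).det = (fderiv ℝ (vectorCoord ε i) v).det := by
  have he : vectorCoord (m := m) ε i ∘ (fun v => -v) = vectorCoord ε i := by
    funext v
    have h : (realCoord m).symm (-v) = (-1 : ℝ) • (realCoord m).symm v := by simp
    simp only [Function.comp_apply, vectorCoord, h, nsq_real_smul, PiLp.neg_apply, neg_div_neg_eq]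
    norm_num
  have hv' : (-v) i ≠ 0 := by simpa using hv
  have h := ((differentiableAt_vectorCoord (ε := ε) hv').hasFDerivAt.comp v
    (hasFDerivAt_id v).neg).fderiv
  have hdet : (-ContinuousLinearMap.id ℝ (RealVec m)).det = 1 := by
    rw [ContinuousLinearMap.det, ← neg_one_smul ℝ (ContinuousLinearMap.id ℝ (RealVec m)),
      ContinuousLinearMap.toLinearMap_smul, LinearMap.det_smul, finrank_euclideanSpace_fin,
      Even.neg_one_pow ⟨m + 1, by ring⟩]
    simp
  change fderiv ℝ (vectorCoord ε i ∘ fun v => -v) v = _ at h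
  rw [he] at h
  rw [h, det_comp_euclidean, hdet, mul_one]

/-- Multiplication of all coordinates except the first by `ε`. -/
def signMap (m : ℕ) (ε : ℝ) :
    RealVec m →L[ℝ] RealVec m :=
  LinearMap.toContinuousLinearMap
    ((WithLp.linearEquiv 2 ℝ (Fin (2 * m + 1 + 1) → ℝ)).symm.toLinearMap ∘ₗ
      Matrix.toLin' (Matrix.diagonal (Fin.cons 1 fun _ => ε)) ∘ₗ
      (WithLp.linearEquiv 2 ℝ (Fin (2 * m + 1 + 1) → ℝ)).toLinearMap)

lemma signMap_apply (ε : ℝ) (x : RealVec m) :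
    signMap m ε x = WithLp.toLp 2 (Fin.cons (x 0) fun j => ε * x (Fin.succ j)) := by
  ext j
  induction j using Fin.cases <;> simp [signMap, Matrix.mulVec_diagonal]

lemma det_signMap (ε : ℝ) : (signMap m ε).det = ε ^ (2 * m + 1) := by
  have h := LinearMap.det_conj (Matrix.toLin' (Matrix.diagonal
    (Fin.cons 1 fun _ => ε : Fin (2 * m + 1 + 1) → ℝ)))
    (WithLp.linearEquiv 2 ℝ (Fin (2 * m + 1 + 1) → ℝ)).symm
  rw [LinearMap.det_toLin', Matrix.det_diagonal, Fin.prod_univ_succ] at h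
  exact h.trans (by simp)

/-- For one of the two signs the collar coordinates preserve the orientation as a function of the
vector. The half-spaces `{0 < v i}` and `{v i < 0}` are each connected, and are exchanged by the
symmetry `v ↦ -v` of the coordinates. -/
lemma exists_collarSign (i : Fin (2 * m + 1 + 1)) :
    ∃ ε : ℝ, ε * ε = 1 ∧ ∀ v : RealVec m, v i ≠ 0 →
      0 < (fderiv ℝ (vectorCoord ε i) v).det := by
  have hsym : ∀ ε : ℝ, (∀ v : RealVec m, 0 < v i →
      0 < (fderiv ℝ (vectorCoord ε i) v).det) → ∀ v : RealVec m,
      v i ≠ 0 → 0 < (fderiv ℝ (vectorCoord ε i) v).det := by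
    intro ε h v hv
    rcases hv.lt_or_gt with hv | hv
    · rw [← det_vectorCoord_neg ε hv.ne]
      exact h _ (by simpa using hv)
    · exact h v hv
  have hcont : ContinuousOn (fun v => (fderiv ℝ (vectorCoord (m := m) 1 i) v).det)
      {v | 0 < v i} :=
    ContinuousLinearMap.continuous_det.comp_continuousOn
      (((contDiffOn_vectorCoord 1 i).continuousOn_fderiv_of_isOpen (isOpen_coord_ne_zero i)
        (by simp)).mono fun v (hv : 0 < v i) => hv.ne')
  have hconn : IsPreconnected {v : RealVec m | 0 < v i} := by
    refine Convex.isPreconnected ?_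
    exact (convex_Ioi (0 : ℝ)).linear_preimage
      (EuclideanSpace.proj i : RealVec m →L[ℝ] ℝ).toLinearMap
  by_cases hpos : ∀ v : RealVec m, 0 < v i →
      0 < (fderiv ℝ (vectorCoord 1 i) v).det
  · exact ⟨1, one_mul 1, hsym 1 hpos⟩
  · push Not at hpos
    obtain ⟨v₀, hv₀, hneg⟩ := hpos
    -- Changing the sign of `2 * m + 1` coordinates, an odd number, changes the sign of the
    -- determinant.
    refine ⟨-1, by norm_num, hsym (-1) fun v hv => ?_⟩
    have hlt : (fderiv ℝ (vectorCoord 1 i) v).det < 0 := by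
      by_contra! h
      obtain ⟨u, hu, hu0⟩ := hconn.intermediate_value hv₀ hv hcont ⟨hneg, h⟩
      exact det_vectorCoord_ne_zero (one_mul 1) hu hu0
    have he : vectorCoord (m := m) (-1) i = signMap m (-1) ∘ vectorCoord 1 i := by
      funext v
      simp [signMap_apply, vectorCoord]
    rw [he, ((signMap m (-1)).hasFDerivAt.comp v
      (differentiableAt_vectorCoord hv.ne').hasFDerivAt).fderiv, det_comp_euclidean, det_signMap,
      Odd.neg_one_pow ⟨m, rfl⟩]
    linarith

/-- The sign that makes the `i`-th collar chart compatible with the complex orientation. -/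
def collarSign (i : Fin (2 * m + 1 + 1)) : ℝ := (exists_collarSign i).choose

lemma collarSign_mul_self (i : Fin (2 * m + 1 + 1)) : collarSign i * collarSign i = 1 :=
  (exists_collarSign i).choose_spec.1

lemma det_vectorCoord_pos {i : Fin (2 * m + 1 + 1)} {v : RealVec m}
    (hv : v i ≠ 0) : 0 < (fderiv ℝ (vectorCoord (collarSign i) i) v).det :=
  (exists_collarSign i).choose_spec.2 v hv

lemma det_collarLift_pos {i : Fin (2 * m + 1 + 1)} {x : RealVec m}
    (hx : x 0 < 1) : 0 < (fderiv ℝ (collarLift (collarSign i) i) x).det := by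
  have h := det_vectorCoord_mul (collarSign_mul_self i) (i := i) hx
  exact pos_of_mul_pos_right (h ▸ one_pos)
    (det_vectorCoord_pos (collarLift_self_pos hx).ne').le

/-- The positively oriented collar chart. -/
abbrev orientedCollarChart (i : Fin (2 * m + 1 + 1)) : HalfSpaceChart (discBundle m) (2 * m + 1) :=
  collarChart (collarSign i) (collarSign_mul_self i) i

lemma det_collar_collar_pos (i i' : Fin (2 * m + 1 + 1))
    {x : RealVec m} (hx : x ∈ (orientedCollarChart i).target)
    (hx' : (orientedCollarChart i).invFun x ∈ (orientedCollarChart i').source) :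
    0 < (fderiv ℝ ((orientedCollarChart i').toFun ∘ (orientedCollarChart i).invFun) x).det := by
  have hne : ∀ y ∈ (orientedCollarChart i).target,
      (orientedCollarChart i).invFun y ∈ (orientedCollarChart i').source →
      collarLift (collarSign i) i y i' ≠ 0 := by
    intro y hy hy' h0
    refine hy'.2 ?_
    have h : (realCoord m).symm (collarLift (collarSign i) i y) ≠ 0 := by
      rw [Ne, EmbeddingLike.map_eq_zero_iff]
      intro h
      have := collarLift_self_pos (ε := collarSign i) (i := i) hy
      simp [h] at this
    change coordMul i' i' (collarInv _ _ _) = 0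
    rw [← lineTensor_collarLift hy, coordMul_lineTensor_one h,
      ContinuousLinearEquiv.apply_symm_apply, h0, zero_mul]
  have e : (orientedCollarChart i').toFun ∘ (orientedCollarChart i).invFun =ᶠ[𝓝 x]
      vectorCoord (collarSign i') i' ∘ collarLift (collarSign i) i := by
    filter_upwards [((orientedCollarChart i).isOpen_transition
      (orientedCollarChart i')).mem_nhds ⟨hx, hx'⟩] with y hy
    change collarCoord _ _ (collarInv _ _ _) = _
    rw [← lineTensor_collarLift hy.1, collarCoord_lineTensor_one,
      ContinuousLinearEquiv.apply_symm_apply, Function.comp_apply]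
    rw [ContinuousLinearEquiv.apply_symm_apply]
    exact hne y hy.1 hy.2
  rw [e.fderiv_eq, fderiv_comp x (differentiableAt_vectorCoord (hne x hx hx'))
    (differentiableAt_collarLift hx), det_comp_euclidean]
  exact mul_pos (det_vectorCoord_pos (hne x hx hx')) (det_collarLift_pos hx)

/-- The bundle charts do not meet the boundary of the collar. -/
lemma zero_lt_of_collarInv_mem {ε : ℝ} {i : Fin (2 * m + 1 + 1)} {l : Fin (m + 1)}
    {x : RealVec m} (hx : x 0 < 1)
    (hx' : collarInv ε i x ∈ (bundleChart l).source) : 0 < x 0 := by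
  rw [← lineTensor_collarLift hx] at hx'
  have hn := nsq_collarLift (ε := ε) (i := i) hx
  have h := norm_mul_nsq_lt_one_of_mem_source hx'
  rw [norm_one, hn] at h
  linarith

lemma det_collar_bundle_pos (i : Fin (2 * m + 1 + 1)) (l : Fin (m + 1))
    {x : RealVec m} (hx : x ∈ (orientedCollarChart i).target)
    (hx' : (orientedCollarChart i).invFun x ∈ (bundleChart l).source) :
    0 < (fderiv ℝ ((bundleChart l).toFun ∘ (orientedCollarChart i).invFun) x).det := by
  have hne : ∀ y ∈ (orientedCollarChart i).target,
      (orientedCollarChart i).invFun y ∈ (bundleChart l).source →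
      (realCoord m).symm (collarLift (collarSign i) i y) l ≠ 0 := by
    intro y hy hy'
    change collarInv _ _ _ ∈ _ at hy'
    rw [← lineTensor_collarLift hy] at hy'
    exact ne_zero_of_mem_source hy'
  -- The coordinate change is `collarLift` followed by a holomorphic function of the complex vector.
  refine lt_of_le_of_ne ?_ ?_
  · have hc := differentiableAt_cons (x := (realCoord m).symm (collarLift (collarSign i) i x))
      differentiableAt_id (t := fun _ => 1) (differentiableAt_const _) (hne x hx hx')
    have key := hasFDerivAt_realCoord_comp hc (differentiableAt_collarLift hx)
    have key' := key.congr_of_eventuallyEq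
      (f₁ := (bundleChart l).toFun ∘ (orientedCollarChart i).invFun) (by
      filter_upwards [((orientedCollarChart i).isOpen_transition
        (bundleChart l)).mem_nhds ⟨hx, hx'⟩] with y hy
      have h := congrArg (fun p => realCoord m p + shift m)
        (bundleCoord_lineTensor (hne y hy.1 hy.2) 1)
      rw [lineTensor_collarLift hy.1] at h
      exact h)
    rw [key'.fderiv, det_comp_euclidean]
    exact mul_nonneg (det_restrictScalars_nonneg _) (det_collarLift_pos hx).le
  · have h := (orientedCollarChart i).det_fderiv_transition_mul (bundleChart l) hx hx'
      (zero_lt_of_collarInv_mem hx hx')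
    exact (right_ne_zero_of_mul (h ▸ one_ne_zero)).symm

lemma det_bundle_collar_pos (l : Fin (m + 1)) (i : Fin (2 * m + 1 + 1))
    {x : RealVec m} (hx : x ∈ (bundleChart l).target)
    (hx' : (bundleChart l).invFun x ∈ (orientedCollarChart i).source) :
    0 < (fderiv ℝ ((orientedCollarChart i).toFun ∘ (bundleChart l).invFun) x).det := by
  have hx0 := zero_lt_of_mem_bundleChart_target hx
  have hW := (bundleChart l).map_target x hx hx0.le
  have h := (bundleChart l).det_fderiv_transition_mul (orientedCollarChart i) hx hx' hx0
  refine pos_of_mul_pos_right (h ▸ one_pos) (det_collar_bundle_pos i l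
    ((orientedCollarChart i).map_source _ hW.1 hx').1 ?_).le
  rw [(orientedCollarChart i).left_inv _ hW.1 hx']
  exact hW.2

/-- The bundle charts and the oriented collar charts. -/
def chartFamily (m : ℕ) :
    Fin (m + 1) ⊕ Fin (2 * m + 1 + 1) → HalfSpaceChart (discBundle m) (2 * m + 1) :=
  Sum.elim bundleChart orientedCollarChart

lemma det_chartFamily_pos (a b : Fin (m + 1) ⊕ Fin (2 * m + 1 + 1))
    (x : RealVec m) (hx : x ∈ (chartFamily m a).target)
    (hx' : (chartFamily m a).invFun x ∈ (chartFamily m b).source) :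
    0 < (fderiv ℝ ((chartFamily m b).toFun ∘ (chartFamily m a).invFun) x).det := by
  rcases a with l | i <;> rcases b with l' | i'
  · exact det_bundle_bundle_pos l l' hx hx'
  · exact det_bundle_collar_pos l i' hx hx'
  · exact det_collar_bundle_pos i l' hx hx'
  · exact det_collar_collar_pos i i' hx hx'

/-! ### The embedding of real projective space -/

lemma chartFamily_covers (w : discBundle m) : ∃ a, w.1 ∈ (chartFamily m a).source := by
  obtain ⟨w, hw⟩ := w
  by_cases h0 : w.2 = 0
  · obtain ⟨z, t, hz, ht, rfl⟩ := exists_lineTensor_eq hw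
    obtain ⟨l, hl⟩ := Function.ne_iff.1 hz
    refine ⟨Sum.inl l, ?_⟩
    change ‖(lineTensor z t).2 l l‖ < (z l * conj (z l) / nsq z).re
    rw [h0, Complex.mul_conj, ← Complex.ofReal_div, Complex.ofReal_re]
    simpa using div_pos (Complex.normSq_pos.2 hl) (nsq_pos hz)
  · obtain ⟨z, hz, _, rfl⟩ := exists_lineTensor_one_eq hw h0
    have hv : realCoord m z ≠ 0 := by
      rwa [Ne, EmbeddingLike.map_eq_zero_iff]
    obtain ⟨i, hi⟩ : ∃ i, realCoord m z i ≠ 0 := by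
      by_contra! h
      exact hv (by ext i; exact h i)
    exact ⟨Sum.inr i, lineTensor_one_mem_collar hi⟩

instance : Nonempty (discBundle m) :=
  ⟨⟨_, lineTensor_mem (t := 0) (z := fun _ => 1) (fun h => one_ne_zero (congrFun h 0)) (by simp)⟩⟩

instance : ChartedSpace (EuclideanHalfSpace (2 * m + 1 + 1)) (discBundle m) :=
  HalfSpaceChart.chartedSpace (chartFamily m) (Classical.arbitrary _) chartFamily_covers

instance : IsManifold (𝓡∂ (2 * m + 1 + 1)) ∞ (discBundle m) :=
  HalfSpaceChart.isManifold (chartFamily m) (Classical.arbitrary _) chartFamily_covers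

/-- The boundary of the disc bundle is the bundle of unit circles. -/
lemma mem_boundary_iff (w : discBundle m) :
    w ∈ (𝓡∂ (2 * m + 1 + 1)).boundary (discBundle m) ↔ fibreNorm w.1 = 1 := by
  refine HalfSpaceChart.mem_boundary_iff (chartFamily m) _ chartFamily_covers w _ fun a ha => ?_
  rcases a with l | i
  · have h1 := zero_lt_of_mem_bundleChart_target ((bundleChart l).map_source w.1 w.2 ha).1
    obtain ⟨z, t, hz, _, hw⟩ := exists_lineTensor_eq w.2
    have ha : w.1 ∈ (bundleChart l).source := ha
    rw [← hw] at ha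
    have h2 : fibreNorm w.1 < 1 := by
      rw [← hw, fibreNorm_lineTensor]
      exact norm_mul_nsq_lt_one_of_mem_source ha
    exact iff_of_false h1.ne' h2.ne
  · change 1 - fibreNorm w.1 = 0 ↔ _
    rw [sub_eq_zero, eq_comm]

/-- The square of the unit vector in the direction of the nonzero vector `v`. -/
def unitSquare (v : RealVec m) : MatrixPair m :=
  lineTensor ((realCoord m).symm v) (((nsq ((realCoord m).symm v))⁻¹ : ℝ) : ℂ)

lemma exists_unitSquare_eq {v : RealVec m} (hv : v ≠ 0) :
    ∃ r : ℝ, r ≠ 0 ∧ nsq ((realCoord m).symm (r • v)) = 1 ∧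
      unitSquare v = lineTensor ((realCoord m).symm (r • v)) 1 := by
  have h0 : (realCoord m).symm v ≠ 0 := by rwa [Ne, EmbeddingLike.map_eq_zero_iff]
  have hn := inv_pos.2 (nsq_pos h0)
  have hr := (Real.sqrt_pos.2 hn).ne'
  refine ⟨√(nsq ((realCoord m).symm v))⁻¹, hr, ?_, ?_⟩
  · rw [map_smul, nsq_real_smul, Real.sq_sqrt hn.le, inv_mul_cancel₀ (nsq_pos h0).ne']
  · rw [map_smul, lineTensor_real_smul hr, Real.sq_sqrt hn.le, mul_one, unitSquare]

lemma unitSquare_smul {a : ℝ} (ha : a ≠ 0) (v : RealVec m) :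
    unitSquare (a • v) = unitSquare v := by
  rw [unitSquare, map_smul, lineTensor_real_smul ha, nsq_real_smul, ← Complex.ofReal_mul, mul_inv,
    mul_inv_cancel_left₀ (pow_ne_zero 2 ha), unitSquare]

lemma unitSquare_mem {v : RealVec m} (hv : v ≠ 0) : unitSquare v ∈ discBundle m := by
  obtain ⟨r, hr, hn, h⟩ := exists_unitSquare_eq hv
  rw [h]
  refine lineTensor_mem ?_ (by rw [hn]; simp)
  rw [Ne, EmbeddingLike.map_eq_zero_iff]
  exact smul_ne_zero hr hv

lemma fibreNorm_unitSquare {v : RealVec m} (hv : v ≠ 0) : fibreNorm (unitSquare v) = 1 := by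
  obtain ⟨r, hr, hn, h⟩ := exists_unitSquare_eq hv
  rw [h, fibreNorm_lineTensor_one, hn]

lemma unitSquare_mem_source_iff {v : RealVec m} (hv : v ≠ 0) (i : Fin (2 * m + 1 + 1)) :
    unitSquare v ∈ (orientedCollarChart i).source ↔ v i ≠ 0 := by
  obtain ⟨r, hr, hn, h⟩ := exists_unitSquare_eq hv
  have hz : (realCoord m).symm (r • v) ≠ 0 := by
    rw [Ne, EmbeddingLike.map_eq_zero_iff]
    exact smul_ne_zero hr hv
  rw [h]
  constructor
  · rintro ⟨-, h⟩ h0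
    rw [coordMul_lineTensor_one hz, ContinuousLinearEquiv.apply_symm_apply, PiLp.smul_apply,
      h0] at h
    simp at h
  · intro h0
    refine lineTensor_one_mem_collar ?_
    rw [ContinuousLinearEquiv.apply_symm_apply]
    exact smul_ne_zero hr h0

lemma collarCoord_unitSquare {v : RealVec m} {i : Fin (2 * m + 1 + 1)} (hi : v i ≠ 0) (ε : ℝ) :
    collarCoord ε i (unitSquare v) =
      WithLp.toLp 2 (Fin.cons 0 fun j => ε * (v (i.succAbove j) / v i)) := by
  have hv : v ≠ 0 := by
    rintro rfl
    exact hi rfl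
  obtain ⟨r, hr, hn, h⟩ := exists_unitSquare_eq hv
  have hz : realCoord m ((realCoord m).symm (r • v)) i ≠ 0 := by
    rw [ContinuousLinearEquiv.apply_symm_apply]
    exact smul_ne_zero hr hi
  rw [h, collarCoord_lineTensor_one hz, ContinuousLinearEquiv.apply_symm_apply, vectorCoord, hn,
    sub_self]
  simp only [PiLp.smul_apply, smul_eq_mul, mul_div_mul_left _ _ hr]

lemma toLp_ne_zero (v : {v : Fin (2 * m + 1 + 1) → ℝ // v ≠ 0}) :
    (WithLp.toLp 2 v.1 : RealVec m) ≠ 0 := fun h =>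
  v.2 (congrArg WithLp.ofLp h)

/-- The map from real projective space to the disc bundle: a line is sent to the square of its unit
vectors. -/
def boundaryMap (m : ℕ) (p : RealProjectiveSpace (2 * m + 1)) : discBundle m :=
  Projectivization.lift (K := ℝ) (V := Fin (2 * m + 1 + 1) → ℝ)
    (fun v => ⟨unitSquare (WithLp.toLp 2 v.1), unitSquare_mem (toLp_ne_zero v)⟩) (by
    rintro ⟨a, ha⟩ ⟨b, hb⟩ t h
    have h0 : t ≠ 0 := by
      rintro rfl
      exact ha (by simpa using h)
    simp only at h
    subst h
    exact Subtype.ext (unitSquare_smul h0 (WithLp.toLp 2 b))) p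

lemma boundaryMap_mk (v : {v : Fin (2 * m + 1 + 1) → ℝ // v ≠ 0}) :
    (boundaryMap m (RealProjectiveSpace.mk v)).1 = unitSquare (WithLp.toLp 2 v.1) := rfl

lemma boundaryMap_mem_source_iff (p : RealProjectiveSpace (2 * m + 1)) (i : Fin (2 * m + 1 + 1)) :
    (boundaryMap m p).1 ∈ (orientedCollarChart i).source ↔
      p ∈ RealProjectiveSpace.affineSet i := by
  obtain ⟨v, rfl⟩ := RealProjectiveSpace.isQuotientMap_mk.surjective p
  rw [boundaryMap_mk, unitSquare_mem_source_iff (toLp_ne_zero v),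
    RealProjectiveSpace.mk_mem_affineSet]

lemma collarCoord_boundaryMap {p : RealProjectiveSpace (2 * m + 1)} {i : Fin (2 * m + 1 + 1)}
    (hp : p ∈ RealProjectiveSpace.affineSet i) (ε : ℝ) :
    collarCoord ε i (boundaryMap m p).1 =
      WithLp.toLp 2 (Fin.cons 0 fun j => ε * RealProjectiveSpace.affineCoord i p j) := by
  obtain ⟨v, rfl⟩ := RealProjectiveSpace.isQuotientMap_mk.surjective p
  exact collarCoord_unitSquare (v := WithLp.toLp 2 v.1) hp ε

lemma continuous_boundaryMap : Continuous (boundaryMap m) := by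
  rw [RealProjectiveSpace.isQuotientMap_mk.continuous_iff, continuous_induced_rng]
  have h : ContDiffOn ℝ ∞ (unitSquare (m := m)) {v | v ≠ 0} := by
    have h0 : ∀ v ∈ {v : RealVec m | v ≠ 0}, (realCoord m).symm v ≠ 0 := fun v hv => by
      rwa [Ne, EmbeddingLike.map_eq_zero_iff]
    refine contDiffOn_lineTensor (realCoord m).symm.contDiff.contDiffOn
      (Complex.ofRealCLM.contDiff.comp_contDiffOn (ContDiffOn.inv
        (contDiff_nsq.comp (realCoord m).symm.contDiff).contDiffOn ?_)) h0
    exact fun v hv => (nsq_pos (h0 v hv)).ne'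
  exact h.continuousOn.comp_continuous
    ((PiLp.continuous_toLp 2 _).comp continuous_subtype_val) toLp_ne_zero

lemma boundaryMap_injective : Function.Injective (boundaryMap m) := by
  intro p q h
  obtain ⟨i, hi⟩ := RealProjectiveSpace.exists_mem_affineSet p
  have hq : q ∈ RealProjectiveSpace.affineSet i := by
    rwa [← boundaryMap_mem_source_iff, ← h, boundaryMap_mem_source_iff]
  have hc := collarCoord_boundaryMap hi 1
  rw [h, collarCoord_boundaryMap hq 1] at hc
  refine (RealProjectiveSpace.affineChart i).injOn hi hq ?_
  ext j
  have hj := congrArg (fun x : RealVec m => x j.succ) hc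
  simp only [Fin.cons_succ, one_mul] at hj
  exact hj.symm

instance compactSpace_realProjectiveSpace {n : ℕ} : CompactSpace (RealProjectiveSpace n) := by
  let g : Metric.sphere (0 : Fin (n + 1) → ℝ) 1 → RealProjectiveSpace n := fun v =>
    RealProjectiveSpace.mk ⟨v.1, ne_zero_of_mem_unit_sphere v⟩
  have hg : Continuous g := RealProjectiveSpace.isQuotientMap_mk.continuous.comp
    (continuous_subtype_val.subtype_mk _)
  refine Function.Surjective.compactSpace (f := g) hg fun p => ?_
  obtain ⟨v, rfl⟩ := RealProjectiveSpace.isQuotientMap_mk.surjective p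
  have hv : ‖v.1‖ ≠ 0 := norm_ne_zero_iff.2 v.2
  refine ⟨⟨‖v.1‖⁻¹ • v.1, ?_⟩, ?_⟩
  · rw [mem_sphere_zero_iff_norm, norm_smul, norm_inv, norm_norm, inv_mul_cancel₀ hv]
  · exact (RealProjectiveSpace.mk_eq_mk_iff _ _).2 ⟨‖v.1‖⁻¹, rfl⟩

lemma range_boundaryMap :
    range (boundaryMap m) = (𝓡∂ (2 * m + 1 + 1)).boundary (discBundle m) := by
  ext w
  rw [mem_boundary_iff]
  constructor
  · rintro ⟨p, rfl⟩
    obtain ⟨v, rfl⟩ := RealProjectiveSpace.isQuotientMap_mk.surjective p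
    exact fibreNorm_unitSquare (toLp_ne_zero v)
  · intro hw
    have h0 : w.1.2 ≠ 0 := by
      intro h
      simp [fibreNorm, h] at hw
    obtain ⟨z, hz, _, hzw⟩ := exists_lineTensor_one_eq w.2 h0
    rw [← hzw, fibreNorm_lineTensor_one] at hw
    have hv : (realCoord m z).ofLp ≠ 0 := by
      intro h
      refine hz ((EmbeddingLike.map_eq_zero_iff (f := realCoord m)).1 ?_)
      ext i
      exact congrFun h i
    refine ⟨RealProjectiveSpace.mk ⟨_, hv⟩, Subtype.ext ?_⟩
    rw [boundaryMap_mk, ← hzw, WithLp.toLp_ofLp, unitSquare,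
      ContinuousLinearEquiv.symm_apply_apply, hw, inv_one, Complex.ofReal_one]

/-- The linear model of the boundary inclusion in the affine and the collar charts. -/
def collarEquiv (m : ℕ) (ε : ℝ) (hε : ε * ε = 1) :
    (EuclideanSpace ℝ (Fin (2 * m + 1)) × ℝ) ≃L[ℝ] RealVec m :=
  LinearEquiv.toContinuousLinearEquiv
  { toFun := fun p => WithLp.toLp 2 (Fin.cons p.2 fun j => ε * p.1 j)
    invFun := fun v => (WithLp.toLp 2 fun j => ε * v (Fin.succ j), v 0)
    map_add' := fun p q => by
      ext j
      induction j using Fin.cases <;> simp [mul_add]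
    map_smul' := fun r p => by
      ext j
      induction j using Fin.cases <;> simp [mul_left_comm]
    left_inv := fun p => by
      ext j
      · simp [← mul_assoc, hε]
      · simp
    right_inv := fun v => by
      ext j
      induction j using Fin.cases <;> simp [← mul_assoc, hε] }

lemma isSmoothEmbedding_boundaryMap :
    Manifold.IsSmoothEmbedding (𝓡 (2 * m + 1)) (𝓡∂ (2 * m + 1 + 1)) ∞ (boundaryMap m) := by
  refine ⟨⟨ℝ, inferInstance, inferInstance, fun p => ?_⟩,
    (continuous_boundaryMap.isClosedEmbedding boundaryMap_injective).isEmbedding⟩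
  obtain ⟨i, hi⟩ := RealProjectiveSpace.exists_mem_affineSet p
  refine Manifold.IsImmersionAtOfComplement.mk_of_charts
    (collarEquiv m (collarSign i) (collarSign_mul_self i)) (RealProjectiveSpace.affineChart i)
    ((orientedCollarChart i).toOpenPartialHomeomorph (Classical.arbitrary _)) hi
    ((boundaryMap_mem_source_iff p i).2 hi)
    (IsManifold.subset_maximalAtlas (mem_range_self i))
    (IsManifold.subset_maximalAtlas ⟨Sum.inr i, rfl⟩)
    (fun q hq => (boundaryMap_mem_source_iff q i).2 hq) ?_
  intro y _
  have hq : (RealProjectiveSpace.affineChart i).symm y ∈ RealProjectiveSpace.affineSet i :=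
    (RealProjectiveSpace.affineChart i).map_target (mem_univ y)
  refine ((orientedCollarChart i).toOpenPartialHomeomorph_coe (Classical.arbitrary _)
    ((boundaryMap_mem_source_iff _ i).2 hq)).trans ?_
  refine (collarCoord_boundaryMap hq (collarSign i)).trans ?_
  have h : RealProjectiveSpace.affineCoord i ((RealProjectiveSpace.affineChart i).symm y) = y :=
    (RealProjectiveSpace.affineChart i).right_inv (mem_univ y)
  rw [h]
  rfl

/-- Every odd-dimensional real projective space bounds a disc bundle. The dimension is a variable
`n` so that the result applies to dimensions that equal `2 * m + 1` without having this form. -/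
theorem exists_oriented_filling (m n : ℕ) (hn : n = 2 * m + 1) :
    ∃ (W : Type) (_ : TopologicalSpace W) (_ : ChartedSpace (EuclideanHalfSpace (n + 1)) W),
      T2Space W ∧ SecondCountableTopology W ∧ CompactSpace W ∧
      IsManifold (𝓡∂ (n + 1)) ∞ W ∧ Nonempty (OrientedAtlas (𝓡∂ (n + 1)) W) ∧
      ∃ f : RealProjectiveSpace n → W,
        Manifold.IsSmoothEmbedding (𝓡 n) (𝓡∂ (n + 1)) ∞ f ∧
        range f = (𝓡∂ (n + 1)).boundary W := by
  subst hn
  exact ⟨discBundle m, inferInstance, inferInstance, inferInstance, inferInstance,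
    isCompact_iff_compactSpace.1 (isCompact_discBundle m), inferInstance,
    ⟨HalfSpaceChart.orientedAtlas _ _ _ fun a b x hx _ => det_chartFamily_pos a b x hx⟩,
    boundaryMap m, isSmoothEmbedding_boundaryMap, range_boundaryMap⟩

end DiscBundle

end

theorem mainTheorem2 (k : ℕ) (hk : 0 < k) :
    ∃ (W : Type) (_ : TopologicalSpace W)
      (_ : ChartedSpace (EuclideanHalfSpace (4 * k + 2)) W),
      T2Space W ∧ SecondCountableTopology W ∧ CompactSpace W ∧
      IsManifold (𝓡∂ (4 * k + 2)) ∞ W ∧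
      Nonempty (OrientedAtlas (𝓡∂ (4 * k + 2)) W) ∧
      ∃ f : RealProjectiveSpace (4 * k + 1) → W,
        Manifold.IsSmoothEmbedding (𝓡 (4 * k + 1)) (𝓡∂ (4 * k + 2)) ∞ f ∧
        Set.range f = (𝓡∂ (4 * k + 2)).boundary W := by
  exact DiscBundle.exists_oriented_filling (2 * k) (4 * k + 1) (by ring)
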